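/- A hypergraph $H=(X,(s_i)_{i\in I})$ consists of a finite vertex set $X$, a finite index set $I$ and hyperedges $s_i\subseteq X$ ($i\in I$), where repeated and empty hyperedges are allowed. A Roman hitting set (rhs) of $H$ is a pair $(R_1,R_2)$ with $R_1\subseteq I$ and $R_2\subseteq X$ such that for each $i\in I$ we have $i\in R_1$ or $s_i\cap R_2\neq\emptyset$; it is minimal if no other rhs $(P_1,P_2)$ satisfies $P_1\subseteq R_1$ and $P_2\subseteq R_2$. Write $n=|X|$ and $m=|I|$. (1) There is an algorithm (one program for a random access machine) that, given any hypergraph $H$ by its incidence matrix, outputs every minimal rhs of $H$ exactly once, outputs nothing else, and halts, and that satisfies the following bounds, where $p,q,r$ are fixed polynomials: the total running time is at most $p(n+m)\cdot 3^{(n+m)/3}$, i.e. $\mathcal{O}^*(3^{(n+m)/3})$; the delay, i.e. the time before the first output, between any two consecutive outputs, and between the last output and termination, is at most $q(n+m)$; and at every moment at most $r(n+m)$ bits of memory are in use (not counting the write-only output). (2) The bound in (1) is tight: for every $k\in\mathbb{N}$ there is a hypergraph with $n=2k$ vertices and $m=k$ hyperedges that has exactly $3^{(n+m)/3}=3^k$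 minimal rhs; hence every program that outputs all minimal rhs of this hypergraph, each exactly once, takes at least $3^{(n+m)/3}$ steps on it. -/

import Mathlib

/-- A finite hypergraph with vertex type `X` and hyperedges indexed by `I`; the same hyperedge may
occur under several indices, and a hyperedge may be empty. -/
structure IndexedHypergraph (X I : Type) where
  edge : I → Finset X

namespace IndexedHypergraph

variable {X I : Type}

/-- `R = (R₁, R₂)` is a Roman hitting set: every index lies in `R₁` or its hyperedge meets `R₂`. -/
def IsRomanHittingSet (H : IndexedHypergraph X I) (R : Finset I × Finset X) : Prop :=
  ∀ i : I, (∃ x ∈ H.edge i, x ∈ R.2) ∨ i ∈ R.1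

/-- Minimality with respect to componentwise inclusion (the product order on pairs of finsets). -/
def IsMinimalRomanHittingSet (H : IndexedHypergraph X I) (R : Finset I × Finset X) : Prop :=
  Minimal H.IsRomanHittingSet R

end IndexedHypergraph

/-! ### Random access machines with an output stream -/

namespace RAM

/-- Instructions. The machine has registers (directly addressed) and a memory (addressed through
registers), both holding natural numbers. It can only append to its output. -/
inductive Instr where
  /-- `reg d := k` -/
  | const (d k : ℕ)
  /-- `reg d := reg a + reg b` -/
  | add (d a b : ℕ)
  /-- `reg d := reg a - reg b`, and `0` if this is negative -/
  | sub (d a b : ℕ)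
  /-- `reg d := mem (reg a)` -/
  | load (d a : ℕ)
  /-- `mem (reg a) := reg b` -/
  | store (a b : ℕ)
  /-- continue at instruction `l` if `reg a = 0` -/
  | jumpZero (a l : ℕ)
  /-- append `reg a` to the output word that is being written -/
  | write (a : ℕ)
  /-- finish the output word that is being written, thereby outputting it, and start a new one -/
  | emit

/-- A program is a finite list of instructions; it does not depend on the input. -/
abbrev Program := List Instr

structure Config where
  /-- program counter -/
  pc : ℕ
  reg : ℕ → ℕ
  mem : ℕ → ℕ
  /-- the output word that is being written -/
  word : List ℕ
  /-- the words output so far, in chronological order -/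
  out : List (List ℕ)

def exec (c : Config) : Instr → Config
  | .const d k => { c with pc := c.pc + 1, reg := Function.update c.reg d k }
  | .add d a b => { c with pc := c.pc + 1, reg := Function.update c.reg d (c.reg a + c.reg b) }
  | .sub d a b => { c with pc := c.pc + 1, reg := Function.update c.reg d (c.reg a - c.reg b) }
  | .load d a => { c with pc := c.pc + 1, reg := Function.update c.reg d (c.mem (c.reg a)) }
  | .store a b => { c with pc := c.pc + 1, mem := Function.update c.mem (c.reg a) (c.reg b) }
  | .jumpZero a l => { c with pc := if c.reg a = 0 then l else c.pc + 1 }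
  | .write a => { c with pc := c.pc + 1, word := c.word ++ [c.reg a] }
  | .emit => { c with pc := c.pc + 1, word := [], out := c.out ++ [c.word] }

/-- One step; the machine has halted when the program counter points beyond the program. -/
def step (P : Program) (c : Config) : Config :=
  match P[c.pc]? with
  | none => c
  | some ins => exec c ins

/-- The configuration after `t` steps. Every instruction counts as one step; together with a bound
on the number of bits held during the run, this bounds the bit cost of the run as well. -/
def run (P : Program) (c : Config) (t : ℕ) : Config :=
  (step P)^[t] c

def Halted (P : Program) (c : Config) : Prop :=
  P.length ≤ c.pc

/-- The machine started in `c` halts after exactly `T` steps. -/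
def HaltsAt (P : Program) (c : Config) (T : ℕ) : Prop :=
  Halted P (run P c T) ∧ ∀ t < T, ¬ Halted P (run P c t)

/-- The nonzero entries of the array `f`, listed as pairs of an address and a content in binary,
take at most `b` bits (with one further bit charged for each pair). -/
def BitsLE (f : ℕ → ℕ) (b : ℕ) : Prop :=
  ∃ s : Finset ℕ, (∀ a ∉ s, f a = 0) ∧ ∑ a ∈ s, (Nat.size a + Nat.size (f a) + 1) ≤ b

/-- Registers and memory together (which include the input) hold at most `b` bits. As usual, the
write-only output is not charged. -/
def SpaceLE (c : Config) (b : ℕ) : Prop :=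
  ∃ b₁ b₂ : ℕ, BitsLE c.reg b₁ ∧ BitsLE c.mem b₂ ∧ b₁ + b₂ ≤ b

end RAM

/-! ### Programs that enumerate minimal Roman hitting sets -/

namespace RomanEnum

open RAM

variable {n m : ℕ}

/-- Input: `n` and `m` in the first two registers, and the incidence matrix, row by row, in the
first `m * n` memory cells; everything else is `0`. -/
def start (H : IndexedHypergraph (Fin n) (Fin m)) : Config where
  pc := 0
  reg := fun r => if r = 0 then n else if r = 1 then m else 0
  mem := fun a => if ∃ (i : Fin m) (x : Fin n), a = i * n + x ∧ x ∈ H.edge i then 1 else 0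
  word := []
  out := []

/-- A pair `(R₁, R₂)` is output as the characteristic vector of `R₁` followed by that of `R₂`. -/
def encode (R : Finset (Fin m) × Finset (Fin n)) : List ℕ :=
  List.ofFn (fun i : Fin m => if i ∈ R.1 then 1 else 0) ++
    List.ofFn (fun x : Fin n => if x ∈ R.2 then 1 else 0)

/-- On input `H` the program halts after exactly `T` steps, and its output consists of all minimal
Roman hitting sets of `H`, each of them exactly once, and nothing else. -/
def EnumeratesInTime (P : Program) (H : IndexedHypergraph (Fin n) (Fin m)) (T : ℕ) : Prop :=
  HaltsAt P (start H) T ∧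
    (run P (start H) T).out.Nodup ∧
    ∀ w : List ℕ, w ∈ (run P (start H) T).out ↔
      ∃ R : Finset (Fin m) × Finset (Fin n), H.IsMinimalRomanHittingSet R ∧ w = encode R

/-- In a run of `T` steps, at any moment before halting, the next output or the end of the run is
at most `d` steps away. This bounds the time before the first output, between two consecutive
outputs, and between the last output and the end. -/
def DelayLE (P : Program) (H : IndexedHypergraph (Fin n) (Fin m)) (T d : ℕ) : Prop :=
  ∀ t < T, T ≤ t + d ∨ (run P (start H) t).out.length < (run P (start H) (t + d)).out.length

end RomanEnum

/-! ### Irredundant vertex sets -/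

namespace IndexedHypergraph

variable {X I : Type} [DecidableEq X]

/-! A minimal rhs is determined by its vertex part `S`: its index part must be the set of hyperedges
that miss `S`, and minimality in the vertex part says that every vertex of `S` has a private
hyperedge, i.e. that `S` is irredundant (`isMinimalRomanHittingSet_iff`). So the task is to count
and to enumerate irredundant sets.

Counting (`cardBound`) is a branching argument with measure `|V| + |E|`. Fixing the trace of `S` on
a set `A` deletes `A`, together with every hyperedge that is already hit or has no candidate
vertices left (`card_filter_inter_le`). With β = 3^(-1/3), a branch that deletes `a` objects
contributes at most the fraction β^a of the claimed bound, so it suffices to find branches covering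
all irredundant sets whose powers of β sum to at most 1. Small hyperedges and vertices of degree
other than 2 give such branches at once. If all degrees are 2, a hyperedge with two vertices even
gives a factor below 1, and this surplus pays for the one remaining configuration, a hyperedge with
three vertices.

Enumeration rests on irredundance being inherited by subsets. If `T` is irredundant and
colexicographically above `S`, and `v` is the largest vertex where they differ, then the part of `S`
above `v`, together with `v`, is a subset of `T`, hence irredundant, and it still lies above `S`. So
the successor of `S` is obtained by binary increment: clear the positions from the bottom up and set
the first vacant one whose resulting set is irredundant (`exists_isPivot_of_lt`,
`advanceState_memory`). No backtracking is needed, and only the current set is stored.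

The machine program is compiled from a loop language in which only `n` and `m` bound loops, so one
pass takes a number of steps depending on `n` and `m` alone (`run_compile`). Each pass outputs one
set and restores the registers, so the run is a sequence of checkpoints at multiples of a fixed
polynomial period. Time, delay and space all follow from this and the count. For tightness, `k`
disjoint pairs have 3^k irredundant sets, and each output costs at least one step. -/

/-- Every vertex of `S` has a private hyperedge among those indexed by `E`. -/
def IsIrredundant (H : IndexedHypergraph X I) (E : Finset I) (S : Finset X) : Prop :=
  ∀ x ∈ S, ∃ i ∈ E, H.edge i ∩ S = {x}

instance (H : IndexedHypergraph X I) (E : Finset I) : DecidablePred (H.IsIrredundant E) :=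
  fun S => inferInstanceAs (Decidable (∀ x ∈ S, ∃ i ∈ E, H.edge i ∩ S = {x}))

/-- The irredundant subsets of `V` with respect to the hyperedges indexed by `E`. -/
def irredundantSets (H : IndexedHypergraph X I) (V : Finset X) (E : Finset I) :
    Finset (Finset X) :=
  V.powerset.filter (H.IsIrredundant E)

theorem mem_irredundantSets {H : IndexedHypergraph X I} {V : Finset X} {E : Finset I}
    {S : Finset X} : S ∈ H.irredundantSets V E ↔ S ⊆ V ∧ H.IsIrredundant E S := by
  simp [irredundantSets]

/-- A private hyperedge of a vertex stays private when other vertices are removed. Both the search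
for successors and its correctness depend on this. -/
theorem IsIrredundant.subset {H : IndexedHypergraph X I} {E : Finset I} {S T : Finset X}
    (hS : H.IsIrredundant E S) (hT : T ⊆ S) : H.IsIrredundant E T := by
  intro x hx
  obtain ⟨i, hi, h⟩ := hS x (hT hx)
  refine ⟨i, hi, ?_⟩
  have hxi : x ∈ H.edge i ∩ S := by simp [h]
  ext y
  constructor
  · intro hy
    rw [← h]
    exact Finset.inter_subset_inter_left hT hy
  · intro hy
    rw [Finset.mem_singleton.1 hy]
    exact Finset.mem_inter.2 ⟨(Finset.mem_inter.1 hxi).1, hx⟩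

theorem isIrredundant_empty (H : IndexedHypergraph X I) (E : Finset I) :
    H.IsIrredundant E ∅ := by
  intro x hx
  simp at hx

/-- The union bound for two branches, in units of the target bound `W`. It is combined with
`card_irredundantSets_le_of_forall`, which applies once the branches are exhaustive. -/
theorem card_filter_or_le {H : IndexedHypergraph X I} {V : Finset X} {E : Finset I}
    {p q : Finset X → Prop} [DecidablePred p] [DecidablePred q] {a b W : ℝ}
    (hp : (((H.irredundantSets V E).filter p).card : ℝ) ≤ a * W)
    (hq : (((H.irredundantSets V E).filter q).card : ℝ) ≤ b * W) :
    (((H.irredundantSets V E).filter (fun S => p S ∨ q S)).card : ℝ) ≤ (a + b) * W := by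
  have : (((H.irredundantSets V E).filter (fun S => p S ∨ q S)).card : ℝ) ≤
      ((H.irredundantSets V E).filter p).card + ((H.irredundantSets V E).filter q).card := by
    rw [Finset.filter_or]
    exact_mod_cast Finset.card_union_le _ _
  linarith

theorem card_irredundantSets_le_of_forall {H : IndexedHypergraph X I} {V : Finset X}
    {E : Finset I} {p : Finset X → Prop} [DecidablePred p] {a b W : ℝ} (hW : 0 ≤ W)
    (hp : (((H.irredundantSets V E).filter p).card : ℝ) ≤ a * W)
    (h : ∀ S ∈ H.irredundantSets V E, p S) (hab : a ≤ b) :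
    ((H.irredundantSets V E).card : ℝ) ≤ b * W := by
  rw [Finset.filter_true_of_mem h] at hp
  exact hp.trans (mul_le_mul_of_nonneg_right hab hW)

theorem mem_filter_of_inter_eq {H : IndexedHypergraph X I} {E : Finset I} {S : Finset X}
    {j : I} {x : X} (hj : j ∈ E) (h : H.edge j ∩ S = {x}) :
    j ∈ E.filter (x ∈ H.edge ·) :=
  Finset.mem_filter.2 ⟨hj, (Finset.mem_inter.1 (h ▸ Finset.mem_singleton_self x)).1⟩

theorem inter_edge_inter_eq {H : IndexedHypergraph X I} {V S : Finset X} {i : I} {x : X}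
    (hSV : S ⊆ V) (h : H.edge i ∩ S = {x}) : S ∩ (H.edge i ∩ V) = {x} := by
  rw [← h]
  ext y
  simp only [Finset.mem_inter]
  constructor
  · rintro ⟨a, b, _⟩
    exact ⟨b, a⟩
  · rintro ⟨a, b⟩
    exact ⟨b, a, hSV b⟩

variable [DecidableEq I]

/-- Fixing the trace `K` of `S` on `A` removes `A` and all hyperedges that can no longer be
private for a vertex outside `A`. -/
theorem card_filter_inter_le (H : IndexedHypergraph X I) {V A K : Finset X} {E D : Finset I}
    (hD : ∀ i ∈ D, (∃ x ∈ K, x ∈ H.edge i) ∨ H.edge i ∩ V ⊆ A) :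
    ((H.irredundantSets V E).filter (fun S => S ∩ A = K)).card ≤
      (H.irredundantSets (V \ A) (E \ D)).card := by
  refine Finset.card_le_card_of_injOn (fun S => S \ A) ?_ ?_
  · intro S hS
    obtain ⟨hS, hSA⟩ := Finset.mem_filter.1 hS
    obtain ⟨hSV, hS⟩ := mem_irredundantSets.1 hS
    refine mem_irredundantSets.2 ⟨Finset.sdiff_subset_sdiff hSV le_rfl, ?_⟩
    intro x hx
    obtain ⟨hxS, hxA⟩ := Finset.mem_sdiff.1 hx
    obtain ⟨i, hi, h⟩ := hS x hxS
    have hxi : x ∈ H.edge i := (Finset.mem_inter.1 (h ▸ Finset.mem_singleton_self x)).1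
    refine ⟨i, Finset.mem_sdiff.2 ⟨hi, fun hiD => ?_⟩, ?_⟩
    -- A private hyperedge of a vertex outside `A` cannot lie in `D`: either it is already hit by a
    -- vertex of the trace, or all its candidates lie in `A`.
    · rcases hD i hiD with ⟨y, hyK, hyi⟩ | hsub
      · rw [← hSA] at hyK
        obtain ⟨hyS, hyA⟩ := Finset.mem_inter.1 hyK
        have : y ∈ H.edge i ∩ S := Finset.mem_inter.2 ⟨hyi, hyS⟩
        rw [h, Finset.mem_singleton] at this
        exact hxA (this ▸ hyA)
      · exact hxA (hsub (Finset.mem_inter.2 ⟨hxi, hSV hxS⟩))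
    · rw [← Finset.inter_sdiff_assoc, h]
      simp [hxA]
  · intro S hS T hT hST
    have hS := (Finset.mem_filter.1 hS).2
    have hT := (Finset.mem_filter.1 hT).2
    rw [← Finset.sdiff_union_inter S A, ← Finset.sdiff_union_inter T A, hS, hT]
    simp only at hST
    rw [hST]

/-! ### The number of irredundant sets -/

/-- The number `3 ^ (1 / 3)`. -/
noncomputable def cbrtThree : ℝ := (3 : ℝ) ^ ((1 : ℝ) / 3)

theorem cbrtThree_pos : 0 < cbrtThree := by unfold cbrtThree; positivity

theorem cbrtThree_pow (k : ℕ) : cbrtThree ^ k = (3 : ℝ) ^ ((k : ℝ) / 3) := by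
  unfold cbrtThree
  rw [← Real.rpow_natCast, ← Real.rpow_mul (by norm_num)]
  congr 1
  ring

theorem inv_cbrtThree_pow_three : (cbrtThree⁻¹) ^ 3 = 1 / 3 := by
  rw [inv_pow, cbrtThree_pow]
  norm_num

/-- Sharp enough for all branches: 0.6934³ only slightly exceeds 1/3. Higher powers of β reduce by
β³ = 1/3, so this upper bound settles the numerical inequalities. -/
theorem inv_cbrtThree_lt : cbrtThree⁻¹ < 0.6934 := by
  by_contra! h
  have h3 := pow_le_pow_left₀ (by norm_num) h 3
  rw [inv_cbrtThree_pow_three] at h3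
  norm_num at h3

theorem inv_cbrtThree_pos : 0 < cbrtThree⁻¹ := inv_pos.2 cbrtThree_pos

/-- The bound `3 ^ ((|V| + |E|) / 3)` on the number of irredundant sets. -/
def CardBound (H : IndexedHypergraph X I) (V : Finset X) (E : Finset I) : Prop :=
  ((H.irredundantSets V E).card : ℝ) ≤ cbrtThree ^ (V.card + E.card)

/-- The bound holds for all smaller instances. -/
def CardBoundBelow (H : IndexedHypergraph X I) (V : Finset X) (E : Finset I) : Prop :=
  ∀ (V' : Finset X) (E' : Finset I), V'.card + E'.card < V.card + E.card → H.CardBound V' E'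

/-- The branch lives on the instance without `A` and `D`, whose measure is smaller by at least `a`;
induction therefore gives the weight β^a. -/
theorem CardBoundBelow.card_filter_le {H : IndexedHypergraph X I} {V A K : Finset X}
    {E D : Finset I} (ih : H.CardBoundBelow V E) (a : ℕ) (ha : 0 < a)
    (hA : A ⊆ V) (hDE : D ⊆ E) (hcard : a ≤ A.card + D.card)
    (hD : ∀ i ∈ D, (∃ x ∈ K, x ∈ H.edge i) ∨ H.edge i ∩ V ⊆ A) :
    (((H.irredundantSets V E).filter (fun S => S ∩ A = K)).card : ℝ) ≤
      (cbrtThree⁻¹) ^ a * cbrtThree ^ (V.card + E.card) := by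
  have h1 := Finset.card_sdiff_add_card_eq_card hA
  have h2 := Finset.card_sdiff_add_card_eq_card hDE
  have hb := ih (V \ A) (E \ D) (by omega)
  have hle : (((H.irredundantSets V E).filter (fun S => S ∩ A = K)).card : ℝ) ≤
      ((H.irredundantSets (V \ A) (E \ D)).card : ℝ) := by
    exact_mod_cast H.card_filter_inter_le hD
  refine hle.trans (hb.trans ?_)
  have hone : (1 : ℝ) ≤ cbrtThree := by
    unfold cbrtThree
    exact Real.one_le_rpow (by norm_num) (by norm_num)
  obtain ⟨c, hc⟩ := Nat.exists_eq_add_of_le (show a ≤ V.card + E.card by omega)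
  rw [hc, inv_pow, pow_add _ a c, inv_mul_cancel_left₀ (pow_pos cbrtThree_pos a).ne']
  exact pow_le_pow_right₀ hone (by omega)

/-! ### Branching rules. -/

theorem inter_singleton_cases (S : Finset X) (x : X) : S ∩ {x} = ∅ ∨ S ∩ {x} = {x} := by
  by_cases h : x ∈ S <;> simp [h]

theorem inter_pair_cases (S : Finset X) (x y : X) :
    (S ∩ {x, y} = ∅ ∨ S ∩ {x, y} = {x}) ∨ S ∩ {x, y} = {y} ∨ S ∩ {x, y} = {x, y} := by
  by_cases h : x ∈ S <;> by_cases h' : y ∈ S <;> simp [h, h', Finset.inter_insert_of_mem,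
    Finset.inter_insert_of_notMem]

/-- Two vertices forming a hyperedge, both of degree two. -/
theorem CardBoundBelow.of_pair {H : IndexedHypergraph X I} {V : Finset X} {E : Finset I}
    (ih : H.CardBoundBelow V E) {i : I} (hi : i ∈ E) {x y : X} (hxy : x ≠ y)
    (hV : H.edge i ∩ V = {x, y})
    (hx : (E.filter (x ∈ H.edge ·)).card = 2) (hy : (E.filter (y ∈ H.edge ·)).card = 2) :
    ((H.irredundantSets V E).card : ℝ) ≤ 0.957 * cbrtThree ^ (V.card + E.card) := by
  have hsub : ({x, y} : Finset X) ⊆ V := hV ▸ Finset.inter_subset_right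
  have hc : ({x, y} : Finset X).card = 2 := Finset.card_pair hxy
  have b0 := ih.card_filter_le (A := {x, y}) (K := ∅) (D := {i}) 3 (by norm_num) hsub
    (by simpa using hi) (by simp [hc]) (by simp [hV])
  have b1 := ih.card_filter_le (A := {x, y}) (K := {x}) (D := E.filter (x ∈ H.edge ·)) 4
    (by norm_num) hsub (Finset.filter_subset _ _) (by omega) (by
      intro j hj
      exact Or.inl ⟨x, by simp, (Finset.mem_filter.1 hj).2⟩)
  have b2 := ih.card_filter_le (A := {x, y}) (K := {y}) (D := E.filter (y ∈ H.edge ·)) 4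
    (by norm_num) hsub (Finset.filter_subset _ _) (by omega) (by
      intro j hj
      exact Or.inl ⟨y, by simp, (Finset.mem_filter.1 hj).2⟩)
  have b3 : (((H.irredundantSets V E).filter (fun S => S ∩ {x, y} = {x, y})).card : ℝ) ≤
      (cbrtThree⁻¹) ^ 5 * cbrtThree ^ (V.card + E.card) := by
    -- If `x` and `y` lie in the same hyperedges, neither can have a private one while both are in
    -- `S`, so this branch is empty. Otherwise at least three hyperedges are hit, and five objects
    -- disappear.
    by_cases hE : E.filter (x ∈ H.edge ·) = E.filter (y ∈ H.edge ·)
    · have : (H.irredundantSets V E).filter (fun S => S ∩ {x, y} = {x, y}) = ∅ := by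
        refine Finset.filter_eq_empty_iff.2 fun S hS hSxy => ?_
        have hxS : x ∈ S := (Finset.mem_inter.1 (hSxy.symm ▸ by simp : x ∈ S ∩ {x, y})).1
        have hyS : y ∈ S := (Finset.mem_inter.1 (hSxy.symm ▸ by simp : y ∈ S ∩ {x, y})).1
        obtain ⟨j, hj, h⟩ := (mem_irredundantSets.1 hS).2 x hxS
        have hxj : x ∈ H.edge j := (Finset.mem_inter.1 (h ▸ Finset.mem_singleton_self x)).1
        have : j ∈ E.filter (y ∈ H.edge ·) := hE ▸ Finset.mem_filter.2 ⟨hj, hxj⟩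
        have : y ∈ H.edge j ∩ S := Finset.mem_inter.2 ⟨(Finset.mem_filter.1 this).2, hyS⟩
        rw [h, Finset.mem_singleton] at this
        exact hxy this.symm
      rw [this]
      have := inv_cbrtThree_pos
      have := cbrtThree_pos
      simp only [Finset.card_empty, Nat.cast_zero]
      positivity
    · refine ih.card_filter_le (A := {x, y}) (K := {x, y})
        (D := E.filter (x ∈ H.edge ·) ∪ E.filter (y ∈ H.edge ·)) 5
        (by norm_num) hsub (Finset.union_subset (Finset.filter_subset _ _)
          (Finset.filter_subset _ _)) ?_ ?_
      · have : (E.filter (x ∈ H.edge ·)).card <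
            (E.filter (x ∈ H.edge ·) ∪ E.filter (y ∈ H.edge ·)).card := by
          refine Finset.card_lt_card (Finset.ssubset_iff_subset_ne.2
            ⟨Finset.subset_union_left, fun h => hE ?_⟩)
          refine (Finset.eq_of_subset_of_card_le ?_ (by omega)).symm
          rw [h]
          exact Finset.subset_union_right
        omega
      · intro j hj
        rcases Finset.mem_union.1 hj with hj | hj
        · exact Or.inl ⟨x, by simp, (Finset.mem_filter.1 hj).2⟩
        · exact Or.inl ⟨y, by simp, (Finset.mem_filter.1 hj).2⟩
  have hW : 0 < cbrtThree ^ (V.card + E.card) := pow_pos cbrtThree_pos _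
  refine card_irredundantSets_le_of_forall hW.le
    (card_filter_or_le (card_filter_or_le b0 b1) (card_filter_or_le b2 b3))
    (fun S _ => inter_pair_cases S x y) ?_
  -- The weights sum to β³ + 2β⁴ + β⁵ = 1/3 + 2β/3 + β²/3, which is about 0.956. The slack below 1
  -- is needed in `of_degree_two`.
  have hβ := inv_cbrtThree_lt
  have hβ0 := inv_cbrtThree_pos
  have h3 := inv_cbrtThree_pow_three
  generalize cbrtThree⁻¹ = β at *
  have h4 : β ^ 4 = β / 3 := by rw [pow_succ, h3]; ring
  have h5 : β ^ 5 = β * β / 3 := by rw [pow_succ, h4]; ring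
  rw [h3, h4, h5]
  nlinarith

/-- A vertex that is not covered, or of degree at least three. -/
theorem CardBoundBelow.of_degree {H : IndexedHypergraph X I} {V : Finset X} {E : Finset I}
    (ih : H.CardBoundBelow V E) {x : X} (hx : x ∈ V)
    (hdeg : (E.filter (x ∈ H.edge ·)).card = 0 ∨ 3 ≤ (E.filter (x ∈ H.edge ·)).card) :
    H.CardBound V E := by
  have hW : 0 < cbrtThree ^ (V.card + E.card) := pow_pos cbrtThree_pos _
  have hβ := inv_cbrtThree_lt
  have b0 := ih.card_filter_le (A := {x}) (K := ∅) (D := ∅) 1 (by norm_num)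
    (by simpa using hx) (by simp) (by simp) (by simp)
  unfold CardBound
  rw [← one_mul (cbrtThree ^ _)]
  rcases hdeg with h0 | h3
  · refine card_irredundantSets_le_of_forall hW.le b0 ?_ (by linarith)
    intro S hS
    rcases inter_singleton_cases S x with h | h
    · exact h
    · have hxS : x ∈ S := (Finset.mem_inter.1 (h.symm ▸ by simp : x ∈ S ∩ {x})).1
      obtain ⟨j, hj, h⟩ := (mem_irredundantSets.1 hS).2 x hxS
      have hxj : x ∈ H.edge j := (Finset.mem_inter.1 (h ▸ Finset.mem_singleton_self x)).1
      have : j ∈ E.filter (x ∈ H.edge ·) := Finset.mem_filter.2 ⟨hj, hxj⟩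
      rw [Finset.card_eq_zero.1 h0] at this
      simp at this
  · have b1 := ih.card_filter_le (A := {x}) (K := {x}) (D := E.filter (x ∈ H.edge ·)) 4
      (by norm_num) (by simpa using hx) (Finset.filter_subset _ _) (by simp; omega) (by
        intro j hj
        exact Or.inl ⟨x, by simp, (Finset.mem_filter.1 hj).2⟩)
    -- Leaving `x` out deletes one object; taking it deletes `x` and at least three hyperedges: β +
    -- β⁴ = 4β/3 < 1.
    refine card_irredundantSets_le_of_forall hW.le (card_filter_or_le b0 b1)
      (fun S _ => inter_singleton_cases S x) ?_
    rw [pow_succ _ 3, inv_cbrtThree_pow_three]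
    linarith

/-- A hyperedge with at most one vertex. -/
theorem CardBoundBelow.of_card_edge_le_one {H : IndexedHypergraph X I} {V : Finset X}
    {E : Finset I} (ih : H.CardBoundBelow V E) {i : I} (hi : i ∈ E)
    (hcard : (H.edge i ∩ V).card ≤ 1) : H.CardBound V E := by
  have hW : 0 < cbrtThree ^ (V.card + E.card) := pow_pos cbrtThree_pos _
  have hβ := inv_cbrtThree_lt
  have hβ0 := inv_cbrtThree_pos
  unfold CardBound
  rw [← one_mul (cbrtThree ^ _)]
  rcases Nat.le_one_iff_eq_zero_or_eq_one.1 hcard with h0 | h1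
  · have b0 := ih.card_filter_le (A := ∅) (K := ∅) (D := {i}) 1 (by norm_num)
      (by simp) (by simpa using hi) (by simp) (by simp [Finset.card_eq_zero.1 h0])
    exact card_irredundantSets_le_of_forall hW.le b0 (by simp) (by linarith)
  · obtain ⟨x, hx⟩ := Finset.card_eq_one.1 h1
    have hxV : x ∈ H.edge i ∩ V := by simp [hx]
    have b0 := fun K => ih.card_filter_le (A := {x}) (K := K) (D := {i}) 2 (by norm_num)
      (by simpa using (Finset.mem_inter.1 hxV).2) (by simpa using hi) (by simp) (by simp [hx])
    -- Once the trace on `x` is fixed, `i` is useless for the other vertices, so both branches lose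
    -- two objects: 2β² < 1.
    refine card_irredundantSets_le_of_forall hW.le (card_filter_or_le (b0 ∅) (b0 {x}))
      (fun S _ => inter_singleton_cases S x) ?_
    nlinarith

/-- A vertex of degree one. -/
theorem CardBoundBelow.of_degree_one {H : IndexedHypergraph X I} {V : Finset X} {E : Finset I}
    (ih : H.CardBoundBelow V E) {x : X} (hx : x ∈ V) {i : I}
    (hdeg : E.filter (x ∈ H.edge ·) = {i}) : H.CardBound V E := by
  have hW : 0 < cbrtThree ^ (V.card + E.card) := pow_pos cbrtThree_pos _
  have hβ := inv_cbrtThree_lt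
  have hβ0 := inv_cbrtThree_pos
  obtain ⟨hi, hxi⟩ := Finset.mem_filter.1 (hdeg ▸ Finset.mem_singleton_self i)
  have hxV : x ∈ H.edge i ∩ V := Finset.mem_inter.2 ⟨hxi, hx⟩
  rcases Nat.lt_or_ge (H.edge i ∩ V).card 2 with h1 | h2
  · exact ih.of_card_edge_le_one hi (by omega)
  have hpriv : ∀ S ∈ H.irredundantSets V E, x ∈ S → H.edge i ∩ S = {x} := by
    intro S hS hxS
    obtain ⟨j, hj, h⟩ := (mem_irredundantSets.1 hS).2 x hxS
    have := mem_filter_of_inter_eq hj h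
    rw [hdeg, Finset.mem_singleton] at this
    exact this ▸ h
  unfold CardBound
  rw [← one_mul (cbrtThree ^ _)]
  rcases h2.eq_or_lt with h2 | h3
  · obtain ⟨y, hy⟩ := Finset.card_eq_one.1
      (show ((H.edge i ∩ V).erase x).card = 1 by rw [Finset.card_erase_of_mem hxV, ← h2])
    have hxy : H.edge i ∩ V = {x, y} := by rw [← Finset.insert_erase hxV, hy]
    have hne : x ≠ y := by
      rintro rfl
      simp [hxy] at h2
    have b := fun K => ih.card_filter_le (A := {x, y}) (K := K) (D := {i}) 3 (by norm_num)
      (hxy ▸ Finset.inter_subset_right) (by simpa using hi) (by simp [Finset.card_pair hne])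
      (by simp [hxy])
    -- The tight case, 3β³ = 1: the trace `{x, y}` is impossible, because `i` is the only hyperedge
    -- that can be private for `x`. Disjoint pairs realize it.
    refine card_irredundantSets_le_of_forall hW.le
      (card_filter_or_le (card_filter_or_le (b ∅) (b {x})) (b {y})) ?_ ?_
    · intro S hS
      rcases inter_pair_cases S x y with h | h | h
      · exact Or.inl h
      · exact Or.inr h
      · have hxS : x ∈ S := (Finset.mem_inter.1 (h.symm ▸ by simp : x ∈ S ∩ {x, y})).1
        have := inter_edge_inter_eq (mem_irredundantSets.1 hS).1 (hpriv S hS hxS)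
        rw [hxy] at this
        exact Or.inl (Or.inr this)
    · rw [inv_cbrtThree_pow_three]
      norm_num
  · have b0 := ih.card_filter_le (A := {x}) (K := ∅) (D := ∅) 1 (by norm_num)
      (by simpa using hx) (by simp) (by simp) (by simp)
    have b1 := ih.card_filter_le (A := H.edge i ∩ V) (K := {x}) (D := {i}) 4 (by norm_num)
      Finset.inter_subset_right (by simpa using hi) (by simp; omega) (by simp)
    -- If `x` is in `S`, no other vertex of `i` is, so at least three vertices and `i` disappear: β
    -- + β⁴ < 1.
    refine card_irredundantSets_le_of_forall hW.le (card_filter_or_le b0 b1) ?_ ?_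
    · intro S hS
      by_cases hxS : x ∈ S
      · exact Or.inr (inter_edge_inter_eq (mem_irredundantSets.1 hS).1 (hpriv S hS hxS))
      · exact Or.inl (by simp [hxS])
    · rw [pow_succ _ 3, inv_cbrtThree_pow_three]
      linarith

/-- All vertices have degree two, and all hyperedges have at least two vertices. -/
theorem CardBoundBelow.of_degree_two {H : IndexedHypergraph X I} {V : Finset X} {E : Finset I}
    (ih : H.CardBoundBelow V E) (hV : V.Nonempty)
    (hdeg : ∀ x ∈ V, (E.filter (x ∈ H.edge ·)).card = 2)
    (hcard : ∀ i ∈ E, 2 ≤ (H.edge i ∩ V).card) : H.CardBound V E := by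
  have hW : 0 < cbrtThree ^ (V.card + E.card) := pow_pos cbrtThree_pos _
  have hβ := inv_cbrtThree_lt
  have hβ0 := inv_cbrtThree_pos
  have hβ3 := inv_cbrtThree_pow_three
  unfold CardBound
  rw [← one_mul (cbrtThree ^ _)]
  by_cases hpair : ∃ i ∈ E, (H.edge i ∩ V).card = 2
  · obtain ⟨i, hi, h2⟩ := hpair
    obtain ⟨x, y, hne, hxy⟩ := Finset.card_eq_two.1 h2
    have hsub : ({x, y} : Finset X) ⊆ V := hxy ▸ Finset.inter_subset_right
    refine (ih.of_pair hi hne hxy (hdeg x (hsub (by simp))) (hdeg y (hsub (by simp)))).trans ?_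
    exact mul_le_mul_of_nonneg_right (by norm_num) hW.le
  have hcard3 : ∀ i ∈ E, 3 ≤ (H.edge i ∩ V).card := by
    intro i hi
    rcases (hcard i hi).eq_or_lt with h | h
    · exact absurd ⟨i, hi, h.symm⟩ hpair
    · exact h
  obtain ⟨x, hx⟩ := hV
  obtain ⟨i, j, hij, hE⟩ := Finset.card_eq_two.1 (hdeg x hx)
  obtain ⟨hi, hxi⟩ := Finset.mem_filter.1 (hE ▸ by simp : i ∈ E.filter (x ∈ H.edge ·))
  obtain ⟨hj, hxj⟩ := Finset.mem_filter.1 (hE ▸ by simp : j ∈ E.filter (x ∈ H.edge ·))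
  -- If `l` is private for `x`, the trace on all of `l` is `{x}`; this deletes the vertices of `l`
  -- and both hyperedges at `x`.
  have hbranch : ∀ (l : I) (a : ℕ), l ∈ E → 0 < a → a ≤ (H.edge l ∩ V).card + 2 →
      (((H.irredundantSets V E).filter (fun S => S ∩ (H.edge l ∩ V) = {x})).card : ℝ) ≤
        (cbrtThree⁻¹) ^ a * cbrtThree ^ (V.card + E.card) := by
    intro l a hl ha hle
    refine ih.card_filter_le (D := E.filter (x ∈ H.edge ·)) a ha Finset.inter_subset_right
      (Finset.filter_subset _ _) (by rw [hdeg x hx]; exact hle) ?_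
    intro k hk
    exact Or.inl ⟨x, by simp, (Finset.mem_filter.1 hk).2⟩
  have hcover : ∀ S ∈ H.irredundantSets V E, S ∩ {x} = ∅ ∨
      (S ∩ (H.edge i ∩ V) = {x} ∨ S ∩ (H.edge j ∩ V) = {x}) := by
    intro S hS
    by_cases hxS : x ∈ S
    · obtain ⟨k, hk, h⟩ := (mem_irredundantSets.1 hS).2 x hxS
      have hkm := mem_filter_of_inter_eq hk h
      have := inter_edge_inter_eq (mem_irredundantSets.1 hS).1 h
      rw [hE, Finset.mem_insert, Finset.mem_singleton] at hkm
      rcases hkm with rfl | rfl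
      · exact Or.inr (Or.inl this)
      · exact Or.inr (Or.inr this)
    · exact Or.inl (by simp [hxS])
  have bj := hbranch j 5 hj (by norm_num) (by have := hcard3 j hj; omega)
  have h5 : (cbrtThree⁻¹) ^ 5 = cbrtThree⁻¹ * cbrtThree⁻¹ / 3 := by
    rw [pow_succ, pow_succ, hβ3]
    ring
  have h6 : (cbrtThree⁻¹) ^ 6 = 1 / 9 := by
    rw [show 6 = 3 * 2 from rfl, pow_mul, hβ3]
    norm_num
  rcases (hcard3 i hi).eq_or_lt with h3 | h4
  · have bi := hbranch i 5 hi (by norm_num) (by omega)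
    have hxm : x ∈ H.edge i ∩ V := Finset.mem_inter.2 ⟨hxi, hx⟩
    obtain ⟨y, z, hne, hyz⟩ := Finset.card_eq_two.1
      (show ((H.edge i ∩ V).erase x).card = 2 by rw [Finset.card_erase_of_mem hxm, ← h3])
    have hyzV : ({y, z} : Finset X) ⊆ V := by
      rw [← hyz]
      exact (Finset.erase_subset _ _).trans Finset.inter_subset_right
    have hcardV : (V.erase x).card + 1 = V.card := Finset.card_erase_add_one hx
    -- Plain branching would give β + 2β⁵ > 1 here. But leaving `x` out turns `i` into a pair whose
    -- vertices still have degree two, so that branch gains the factor 0.957.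
    have hp : CardBoundBelow H (V.erase x) E := fun V' E' h => ih V' E' (by omega)
    have hp := hp.of_pair hi hne (by rw [← hyz, Finset.inter_erase])
      (hdeg y (hyzV (by simp))) (hdeg z (hyzV (by simp)))
    have b0 : (((H.irredundantSets V E).filter (fun S => S ∩ {x} = ∅)).card : ℝ) ≤
        0.957 * cbrtThree⁻¹ * cbrtThree ^ (V.card + E.card) := by
      have h := H.card_filter_inter_le (V := V) (A := {x}) (K := ∅) (E := E) (D := ∅) (by simp)
      rw [Finset.sdiff_empty, Finset.sdiff_singleton_eq_erase] at h
      refine (Nat.cast_le.2 h).trans (hp.trans ?_)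
      rw [← hcardV, add_right_comm, pow_succ, mul_assoc, mul_comm (cbrtThree ^ _),
        inv_mul_cancel_left₀ cbrtThree_pos.ne']
    refine card_irredundantSets_le_of_forall hW.le
      (card_filter_or_le b0 (card_filter_or_le bi bj)) hcover ?_
    rw [h5]
    nlinarith
  -- With at least four vertices in `i`, the plain sum β + β⁶ + β⁵ is already below 1.
  · have bi := hbranch i 6 hi (by norm_num) (by omega)
    have b0 := ih.card_filter_le (A := {x}) (K := ∅) (D := ∅) 1 (by norm_num)
      (by simpa using hx) (by simp) (by simp) (by simp)
    refine card_irredundantSets_le_of_forall hW.le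
      (card_filter_or_le b0 (card_filter_or_le bi bj)) hcover ?_
    rw [h5, h6]
    nlinarith

theorem cardBound (H : IndexedHypergraph X I) (V : Finset X) (E : Finset I) :
    H.CardBound V E := by
  induction hN : V.card + E.card using Nat.strong_induction_on generalizing V E with
  | _ N ihN =>
    have ih : H.CardBoundBelow V E := fun V' E' h => ihN _ (hN ▸ h) V' E' rfl
    rcases V.eq_empty_or_nonempty with rfl | hV
    · have h1 : (1 : ℝ) ≤ cbrtThree := by
        unfold cbrtThree
        exact Real.one_le_rpow (by norm_num) (by norm_num)
      refine le_trans ?_ (one_le_pow₀ h1)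
      have : (H.irredundantSets ∅ E).card ≤ 1 := by
        simpa [irredundantSets] using Finset.card_filter_le ({∅} : Finset (Finset X)) _
      exact_mod_cast this
    by_cases hcard : ∃ i ∈ E, (H.edge i ∩ V).card ≤ 1
    · obtain ⟨i, hi, h⟩ := hcard
      exact ih.of_card_edge_le_one hi h
    by_cases hdeg : ∃ x ∈ V, (E.filter (x ∈ H.edge ·)).card ≠ 2
    · obtain ⟨x, hx, h⟩ := hdeg
      by_cases h1 : (E.filter (x ∈ H.edge ·)).card = 1
      · obtain ⟨i, hi⟩ := Finset.card_eq_one.1 h1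
        exact ih.of_degree_one hx hi
      · exact ih.of_degree hx (by omega)
    push Not at hcard hdeg
    exact ih.of_degree_two hV hdeg hcard

end IndexedHypergraph

/-! ### Runs of random access machines -/

namespace RAM

theorem run_add (P : Program) (c : Config) (s t : ℕ) :
    run P c (s + t) = run P (run P c s) t := by
  unfold run
  rw [add_comm, Function.iterate_add_apply]

theorem run_succ (P : Program) (c : Config) (t : ℕ) :
    run P c (t + 1) = step P (run P c t) :=
  Function.iterate_succ_apply' _ _ _

theorem step_of_halted {P : Program} {c : Config} (h : Halted P c) : step P c = c := by
  unfold step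
  rw [List.getElem?_eq_none h]

theorem run_of_halted {P : Program} {c : Config} (h : Halted P c) (t : ℕ) : run P c t = c := by
  induction t with
  | zero => rfl
  | succ t ih => rw [run_succ, ih, step_of_halted h]

theorem out_length_step (P : Program) (c : Config) :
    c.out.length ≤ (step P c).out.length ∧ (step P c).out.length ≤ c.out.length + 1 := by
  unfold step
  split
  · simp
  · rename_i ins _
    cases ins <;> simp [exec]

theorem monotone_out_length (P : Program) (c : Config) :
    Monotone fun t => (run P c t).out.length :=
  monotone_nat_of_le_succ fun t => by
    rw [run_succ]
    exact (out_length_step P _).1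

theorem out_length_run_le (P : Program) (c : Config) (t : ℕ) :
    (run P c t).out.length ≤ c.out.length + t := by
  induction t with
  | zero => simp [run]
  | succ t ih =>
    rw [run_succ]
    have := (out_length_step P (run P c t)).2
    omega

/-- A run that passes through a checkpoint every `d` steps, outputs one word between any two
consecutive checkpoints, and has halted at the last one. -/
theorem exists_haltsAt_of_checkpoints {P : Program} {c : Config} {d N : ℕ} (hd : 0 < d)
    (hN : 0 < N) (hlen : ∀ k ≤ N, (run P c (k * d)).out.length = k)
    (hhalt : Halted P (run P c (N * d))) :
    ∃ T ≤ N * d, HaltsAt P c T ∧ run P c T = run P c (N * d) ∧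
      (∀ t < T, T ≤ t + 2 * d ∨ (run P c t).out.length < (run P c (t + 2 * d)).out.length) ∧
      ∀ t ≤ T, ∃ k < N, ∃ j ≤ d, run P c t = run P (run P c (k * d)) j := by
  classical
  have hex : ∃ t, Halted P (run P c t) := ⟨_, hhalt⟩
  have hT : Nat.find hex ≤ N * d := Nat.find_min' hex hhalt
  refine ⟨Nat.find hex, hT, ⟨Nat.find_spec hex, fun t ht => Nat.find_min hex ht⟩, ?_, ?_, ?_⟩
  · obtain ⟨e, he⟩ := Nat.exists_eq_add_of_le hT
    rw [he, run_add, run_of_halted (Nat.find_spec hex)]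
  · intro t ht
    have hlt : t ≤ (t / d + 1) * d := by
      have := Nat.lt_mul_div_succ t hd
      rw [mul_comm]
      exact this.le
    -- Every window of length `2 * d` contains a full period between consecutive checkpoints, hence
    -- an output; this is where the factor 2 in the delay comes from.
    have hle : (t / d + 2) * d ≤ t + 2 * d := by
      have := Nat.div_mul_le_self t d
      rw [add_mul]
      omega
    by_cases hk : t / d + 2 ≤ N
    · right
      have h1 : (run P c t).out.length ≤ (run P c ((t / d + 1) * d)).out.length :=
        monotone_out_length P c hlt
      have h2 : (run P c ((t / d + 2) * d)).out.length ≤ (run P c (t + 2 * d)).out.length :=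
        monotone_out_length P c hle
      rw [hlen _ (by omega)] at h1 h2
      omega
    · left
      have : N * d ≤ (t / d + 2) * d := Nat.mul_le_mul_right d (by omega)
      omega
  · intro t ht
    by_cases htN : t < N * d
    · refine ⟨t / d, (Nat.div_lt_iff_lt_mul hd).2 htN, t % d, (Nat.mod_lt t hd).le, ?_⟩
      rw [← run_add, mul_comm, Nat.div_add_mod]
    -- The final moment is counted as `d` steps after the last checkpoint before halting, which is
    -- why `j = d` is allowed.
    · refine ⟨N - 1, by omega, d, le_rfl, ?_⟩
      rw [← run_add, ← Nat.succ_mul, Nat.succ_eq_add_one, Nat.sub_add_cancel hN]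
      congr 1
      omega

/-! ### Growth of the memory in use -/

/-- At most `N` entries of `f` are nonzero, and their addresses and contents have at most `b`
bits. -/
def SizeLE (f : ℕ → ℕ) (N b : ℕ) : Prop :=
  ∃ s : Finset ℕ, s.card ≤ N ∧ (∀ a ∈ s, a < 2 ^ b) ∧ (∀ a ∉ s, f a = 0) ∧ ∀ a, f a < 2 ^ b

theorem SizeLE.mono {f : ℕ → ℕ} {N N' b b' : ℕ} (h : SizeLE f N b) (hN : N ≤ N') (hb : b ≤ b') :
    SizeLE f N' b' := by
  obtain ⟨s, h1, h2, h3, h4⟩ := h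
  have := Nat.pow_le_pow_right (show 0 < 2 by norm_num) hb
  exact ⟨s, h1.trans hN, fun a ha => (h2 a ha).trans_le this, h3, fun a => (h4 a).trans_le this⟩

theorem SizeLE.update {f : ℕ → ℕ} {N b a v : ℕ} (h : SizeLE f N b) (ha : a < 2 ^ b)
    (hv : v < 2 ^ b) : SizeLE (Function.update f a v) (N + 1) b := by
  obtain ⟨s, h1, h2, h3, h4⟩ := h
  refine ⟨insert a s, (Finset.card_insert_le _ _).trans (by omega), ?_, ?_, ?_⟩
  · intro x hx
    rcases Finset.mem_insert.1 hx with rfl | hx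
    · exact ha
    · exact h2 x hx
  · intro x hx
    rw [Finset.mem_insert, not_or] at hx
    rw [Function.update_of_ne hx.1]
    exact h3 x hx.2
  · intro x
    rw [Function.update_apply]
    split_ifs
    · exact hv
    · exact h4 x

theorem SizeLE.bitsLE {f : ℕ → ℕ} {N b : ℕ} (h : SizeLE f N b) :
    BitsLE f (N * (2 * b + 1)) := by
  obtain ⟨s, h1, h2, h3, h4⟩ := h
  refine ⟨s, h3, ?_⟩
  calc ∑ a ∈ s, (Nat.size a + Nat.size (f a) + 1) ≤ ∑ _a ∈ s, (2 * b + 1) := by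
        refine Finset.sum_le_sum fun a ha => ?_
        have := Nat.size_le.2 (h2 a ha)
        have := Nat.size_le.2 (h4 a)
        omega
    _ = s.card * (2 * b + 1) := by simp
    _ ≤ N * (2 * b + 1) := Nat.mul_le_mul_right _ h1

/-- Every register and every constant that the instruction mentions has at most `b` bits. -/
def Instr.SizeLE (b : ℕ) : Instr → Prop
  | .const d k => d < 2 ^ b ∧ k < 2 ^ b
  | .add d _ _ => d < 2 ^ b
  | .sub d _ _ => d < 2 ^ b
  | .load d _ => d < 2 ^ b
  | _ => True

theorem Instr.SizeLE.mono {b b' : ℕ} {i : Instr} (h : i.SizeLE b) (hb : b ≤ b') :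
    i.SizeLE b' := by
  have := Nat.pow_le_pow_right (show 0 < 2 by norm_num) hb
  cases i <;> simp only [Instr.SizeLE] at * <;> omega

/-- The bound depends on the program only, so it enters the space polynomial as a constant. -/
theorem exists_forall_sizeLE (P : Program) : ∃ b, ∀ i ∈ P, i.SizeLE b := by
  induction P with
  | nil => exact ⟨0, by simp⟩
  | cons i P ih =>
    obtain ⟨b, hb⟩ := ih
    have : ∃ b', i.SizeLE b' := by
      cases i with
      | const d k =>
        refine ⟨d + k, (Nat.lt_two_pow_self (n := d)).trans_le ?_,
          (Nat.lt_two_pow_self (n := k)).trans_le ?_⟩ <;>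
        exact Nat.pow_le_pow_right (by norm_num) (by omega)
      | add d _ _ => exact ⟨d, Nat.lt_two_pow_self⟩
      | sub d _ _ => exact ⟨d, Nat.lt_two_pow_self⟩
      | load d _ => exact ⟨d, Nat.lt_two_pow_self⟩
      | store _ _ => exact ⟨0, trivial⟩
      | jumpZero _ _ => exact ⟨0, trivial⟩
      | write _ => exact ⟨0, trivial⟩
      | emit => exact ⟨0, trivial⟩
    obtain ⟨b', hb'⟩ := this
    refine ⟨b + b', fun j hj => ?_⟩
    rcases List.mem_cons.1 hj with rfl | hj
    · exact hb'.mono (by omega)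
    · exact (hb j hj).mono (by omega)

/-- Both arrays of a configuration are bounded. -/
def Config.SizeLE (c : Config) (N b : ℕ) : Prop :=
  RAM.SizeLE c.reg N b ∧ RAM.SizeLE c.mem N b

theorem Config.SizeLE.spaceLE {c : Config} {N b : ℕ} (h : c.SizeLE N b) :
    SpaceLE c (N * (2 * b + 1) + N * (2 * b + 1)) :=
  ⟨_, _, h.1.bitsLE, h.2.bitsLE, le_rfl⟩

/-- One instruction changes at most one cell, and addition at most doubles the largest content.
Entry count and bit length thus grow by at most one per step. This crude estimate suffices because
it is only used within a single period. -/
theorem Config.SizeLE.step {P : Program} {c : Config} {N b : ℕ} (h : c.SizeLE N b)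
    (hP : ∀ i ∈ P, i.SizeLE b) : (step P c).SizeLE (N + 1) (b + 1) := by
  have hr : ∀ a, c.reg a < 2 ^ b := by
    obtain ⟨s, -, -, -, h4⟩ := h.1
    exact h4
  have hm : ∀ a, c.mem a < 2 ^ b := by
    obtain ⟨s, -, -, -, h4⟩ := h.2
    exact h4
  have h1 : RAM.SizeLE c.reg N (b + 1) := h.1.mono le_rfl (by omega)
  have h2 : RAM.SizeLE c.mem N (b + 1) := h.2.mono le_rfl (by omega)
  have hpow : 2 ^ (b + 1) = 2 ^ b + 2 ^ b := by rw [pow_succ, mul_two]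
  unfold RAM.step
  split
  · exact ⟨h1.mono (by omega) le_rfl, h2.mono (by omega) le_rfl⟩
  · rename_i ins hins
    have hi := hP ins (List.mem_of_getElem? hins)
    cases ins with
    | const d k =>
      exact ⟨h1.update (by rw [hpow]; have := hi.1; omega) (by rw [hpow]; have := hi.2; omega),
        h2.mono (by omega) le_rfl⟩
    | add d x y =>
      simp only [Instr.SizeLE] at hi
      exact ⟨h1.update (by omega) (by have := hr x; have := hr y; omega),
        h2.mono (by omega) le_rfl⟩
    | sub d x y =>
      simp only [Instr.SizeLE] at hi
      exact ⟨h1.update (by omega) (by have := hr x; omega), h2.mono (by omega) le_rfl⟩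
    | load d x =>
      simp only [Instr.SizeLE] at hi
      exact ⟨h1.update (by omega) (by have := hm (c.reg x); omega), h2.mono (by omega) le_rfl⟩
    | store x y =>
      exact ⟨h1.mono (by omega) le_rfl,
        h2.update (by have := hr x; omega) (by have := hr y; omega)⟩
    | jumpZero x l => exact ⟨h1.mono (by omega) le_rfl, h2.mono (by omega) le_rfl⟩
    | write x => exact ⟨h1.mono (by omega) le_rfl, h2.mono (by omega) le_rfl⟩
    | emit => exact ⟨h1.mono (by omega) le_rfl, h2.mono (by omega) le_rfl⟩

theorem Config.SizeLE.run {P : Program} {c : Config} {N b : ℕ} (h : c.SizeLE N b)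
    (hP : ∀ i ∈ P, i.SizeLE b) (t : ℕ) : (run P c t).SizeLE (N + t) (b + t) := by
  induction t with
  | zero => exact h
  | succ t ih =>
    rw [run_succ]
    exact ih.step fun i hi => (hP i hi).mono (by omega)

/-! ### Loop programs -/

/-- The contents of a configuration, without the program counter. -/
structure Data where
  reg : ℕ → ℕ
  mem : ℕ → ℕ
  word : List ℕ
  out : List (List ℕ)

/-- The configuration with contents `d` and program counter `l`. -/
def Data.at (d : Data) (l : ℕ) : Config :=
  ⟨l, d.reg, d.mem, d.word, d.out⟩

/-- Commands of a loop language. The command `loop r k c` repeats `c` as often as the content of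
register `r` says, with `k` as counter. -/
inductive Cmd where
  | const (d k : ℕ)
  | add (d a b : ℕ)
  | sub (d a b : ℕ)
  | load (d a : ℕ)
  | store (a b : ℕ)
  | write (a : ℕ)
  | emit
  | seq (c₁ c₂ : Cmd)
  | loop (r k : ℕ) (c : Cmd)

namespace Cmd

/-- Decrement register `k`, and set the auxiliary register `2` to `0`. -/
def tick (k : ℕ) (d : Data) : Data :=
  { d with reg := Function.update (Function.update d.reg k (d.reg k - 1)) 2 0 }

/-- The effect of a command. -/
def den : Cmd → Data → Data
  | const d k, s => { s with reg := Function.update s.reg d k }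
  | add d a b, s => { s with reg := Function.update s.reg d (s.reg a + s.reg b) }
  | sub d a b, s => { s with reg := Function.update s.reg d (s.reg a - s.reg b) }
  | load d a, s => { s with reg := Function.update s.reg d (s.mem (s.reg a)) }
  | store a b, s => { s with mem := Function.update s.mem (s.reg a) (s.reg b) }
  | write a, s => { s with word := s.word ++ [s.reg a] }
  | emit, s => { s with word := [], out := s.out ++ [s.word] }
  | seq c₁ c₂, s => den c₂ (den c₁ s)
  | loop r k c, s =>
    (fun s => tick k (den c s))^[s.reg r] { s with reg := Function.update s.reg k (s.reg r) }

theorem den_seq (c₁ c₂ : Cmd) (s : Data) : den (seq c₁ c₂) s = den c₂ (den c₁ s) := rfl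

/-- The registers that a command may change. -/
def writes : Cmd → List ℕ
  | const d _ => [d]
  | add d _ _ => [d]
  | sub d _ _ => [d]
  | load d _ => [d]
  | store _ _ => []
  | write _ => []
  | emit => []
  | seq c₁ c₂ => writes c₁ ++ writes c₂
  | loop _ k c => 2 :: k :: writes c

/-- The command does not store into the memory. -/
def keepsMem : Cmd → Bool
  | store _ _ => false
  | seq c₁ c₂ => keepsMem c₁ && keepsMem c₂
  | loop _ _ c => keepsMem c
  | _ => true

/-- The command does not output anything. -/
def silent : Cmd → Bool
  | write _ => false
  | emit => false
  | seq c₁ c₂ => silent c₁ && silent c₂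
  | loop _ _ c => silent c
  | _ => true

/-- Only the registers `0` and `1` bound loops, and they are never changed; loop counters are not
changed in the body of their loop. -/
def wellFormed : Cmd → Bool
  | const d _ => decide (2 ≤ d)
  | add d _ _ => decide (2 ≤ d)
  | sub d _ _ => decide (2 ≤ d)
  | load d _ => decide (2 ≤ d)
  | seq c₁ c₂ => wellFormed c₁ && wellFormed c₂
  | loop r k c => decide (r < 2 ∧ 2 < k ∧ k ∉ writes c) && wellFormed c
  | _ => true

/-- The number of instructions of the compiled command. -/
def size : Cmd → ℕ
  | seq c₁ c₂ => size c₁ + size c₂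
  | loop _ _ c => size c + 7
  | _ => 1

/-- The instructions of a command, to be placed at address `l`. -/
def compile : Cmd → ℕ → Program
  | const d k, _ => [.const d k]
  | add d a b, _ => [.add d a b]
  | sub d a b, _ => [.sub d a b]
  | load d a, _ => [.load d a]
  | store a b, _ => [.store a b]
  | write a, _ => [.write a]
  | emit, _ => [.emit]
  | seq c₁ c₂, l => compile c₁ l ++ compile c₂ (l + size c₁)
  | loop r k c, l =>
    [.const k 0, .add k k r, .jumpZero k (l + (size c + 7))] ++ (compile c (l + 3) ++
      [.const 2 1, .sub k k 2, .const 2 0, .jumpZero 2 (l + 2)])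

/-- The running time of a command if registers `0` and `1` hold `n` and `m`. -/
def cost (n m : ℕ) : Cmd → ℕ
  | seq c₁ c₂ => cost n m c₁ + cost n m c₂
  | loop r _ c => 3 + (if r = 0 then n else m) * (cost n m c + 5)
  | _ => 1

/-- A polynomial bound for `cost`. -/
noncomputable def costPoly : Cmd → Polynomial ℕ
  | seq c₁ c₂ => costPoly c₁ + costPoly c₂
  | loop _ _ c => 3 + Polynomial.X * (costPoly c + 5)
  | _ => 1

theorem cost_le (n m : ℕ) (c : Cmd) : cost n m c ≤ (costPoly c).eval (n + m) := by
  induction c with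
  | seq c₁ c₂ h₁ h₂ =>
    simp only [cost, costPoly, Polynomial.eval_add]
    omega
  | loop r k c h =>
    simp only [cost, costPoly, Polynomial.eval_add, Polynomial.eval_mul, Polynomial.eval_X,
      Polynomial.eval_ofNat]
    have : (if r = 0 then n else m) ≤ n + m := by split_ifs <;> omega
    gcongr
  | _ => simp [cost, costPoly]

theorem length_compile (c : Cmd) (l : ℕ) : (compile c l).length = size c := by
  induction c generalizing l with
  | seq c₁ c₂ h₁ h₂ => simp [compile, size, h₁, h₂]
  | loop r k c h =>
    simp only [compile, size, List.length_append, h, List.length_cons, List.length_nil]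
    omega
  | _ => rfl

theorem reg_tick {k r : ℕ} (d : Data) (hk : r ≠ k) (h2 : r ≠ 2) :
    (tick k d).reg r = d.reg r := by
  simp [tick, hk, h2]

/-- The frame rule. Membership in `writes` is decidable on syntax, so specifications of subroutines
need only mention their results; `mem_den` and `out_den` play the same role for memory and output.
-/
theorem reg_den {c : Cmd} {r : ℕ} (hr : r ∉ writes c) (d : Data) :
    (den c d).reg r = d.reg r := by
  induction c generalizing d with
  | seq c₁ c₂ h₁ h₂ =>
    simp only [writes, List.mem_append, not_or] at hr
    simp only [den]
    rw [h₂ hr.2, h₁ hr.1]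
  | loop q k c h =>
    simp only [writes, List.mem_cons, not_or] at hr
    simp only [den]
    have : ∀ (j : ℕ) (e : Data), ((fun s => tick k (den c s))^[j] e).reg r = e.reg r := by
      intro j
      induction j with
      | zero => intro e; rfl
      | succ j ih =>
        intro e
        rw [Function.iterate_succ_apply, ih, reg_tick _ hr.2.1 hr.1, h hr.2.2]
    rw [this]
    simp [hr.2.1]
  | store | write | emit => rfl
  | _ =>
    simp only [writes, List.mem_singleton] at hr
    simp [den, hr]

theorem mem_den {c : Cmd} (hc : keepsMem c = true) (d : Data) : (den c d).mem = d.mem := by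
  induction c generalizing d with
  | seq c₁ c₂ h₁ h₂ =>
    simp only [keepsMem, Bool.and_eq_true] at hc
    simp only [den]
    rw [h₂ hc.2, h₁ hc.1]
  | loop q k c h =>
    simp only [den]
    have : ∀ (j : ℕ) (e : Data), ((fun s => tick k (den c s))^[j] e).mem = e.mem := by
      intro j
      induction j with
      | zero => intro e; rfl
      | succ j ih =>
        intro e
        rw [Function.iterate_succ_apply, ih]
        exact h hc e
    rw [this]
  | store => simp [keepsMem] at hc
  | _ => rfl

theorem out_den {c : Cmd} (hc : silent c = true) (d : Data) :
    (den c d).word = d.word ∧ (den c d).out = d.out := by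
  induction c generalizing d with
  | seq c₁ c₂ h₁ h₂ =>
    simp only [silent, Bool.and_eq_true] at hc
    simp only [den]
    rw [(h₂ hc.2 _).1, (h₂ hc.2 _).2]
    exact h₁ hc.1 d
  | loop q k c h =>
    simp only [den]
    have : ∀ (j : ℕ) (e : Data), ((fun s => tick k (den c s))^[j] e).word = e.word ∧
        ((fun s => tick k (den c s))^[j] e).out = e.out := by
      intro j
      induction j with
      | zero => intro e; exact ⟨rfl, rfl⟩
      | succ j ih =>
        intro e
        rw [Function.iterate_succ_apply, (ih _).1, (ih _).2]
        exact h hc e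
    exact this _ _
  | write => simp [silent] at hc
  | emit => simp [silent] at hc
  | _ => exact ⟨rfl, rfl⟩

theorem two_le_of_mem_writes {c : Cmd} (hc : wellFormed c = true) {r : ℕ} (hr : r ∈ writes c) :
    2 ≤ r := by
  induction c with
  | seq c₁ c₂ h₁ h₂ =>
    simp only [wellFormed, Bool.and_eq_true] at hc
    rcases List.mem_append.1 hr with hr | hr
    · exact h₁ hc.1 hr
    · exact h₂ hc.2 hr
  | loop q k c h =>
    simp only [wellFormed, Bool.and_eq_true, decide_eq_true_eq] at hc
    simp only [writes, List.mem_cons] at hr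
    rcases hr with rfl | rfl | hr
    · exact le_rfl
    · exact hc.1.2.1.le
    · exact h hc.2 hr
  | store | write | emit => simp [writes] at hr
  | _ =>
    simp only [writes, List.mem_singleton] at hr
    simp only [wellFormed, decide_eq_true_eq] at hc
    omega

theorem reg_den_of_lt_two {c : Cmd} (hc : wellFormed c = true) {r : ℕ} (hr : r < 2) (d : Data) :
    (den c d).reg r = d.reg r :=
  reg_den (fun h => by have := two_le_of_mem_writes hc h; omega) d

/-- Induction over the iterations of a loop; what the loop does not touch need not be part of the
invariant. -/
theorem den_loop {r k : ℕ} {c : Cmd} {d : Data} (inv : ℕ → Data → Prop)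
    (h0 : inv 0 { d with reg := Function.update d.reg k (d.reg r) })
    (hs : ∀ (j : ℕ) (e : Data), j < d.reg r →
      (∀ q ∉ writes (loop r k c), e.reg q = d.reg q) → inv j e → inv (j + 1) (tick k (den c e))) :
    inv (d.reg r) (den (loop r k c) d) := by
  have : ∀ j ≤ d.reg r, inv j ((fun s => tick k (den c s))^[j]
      { d with reg := Function.update d.reg k (d.reg r) }) ∧
      ∀ q ∉ writes (loop r k c), ((fun s => tick k (den c s))^[j]
        { d with reg := Function.update d.reg k (d.reg r) }).reg q = d.reg q := by
    intro j
    induction j with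
    | zero =>
      intro _
      refine ⟨h0, fun q hq => ?_⟩
      simp only [writes, List.mem_cons, not_or] at hq
      simp [hq.2.1]
    | succ j ih =>
      intro hj
      obtain ⟨h1, h2⟩ := ih (by omega)
      rw [Function.iterate_succ_apply']
      refine ⟨hs j _ (by omega) h2 h1, fun q hq => ?_⟩
      rw [← h2 q hq]
      simp only [writes, List.mem_cons, not_or] at hq
      rw [reg_tick _ hq.2.1 hq.1, reg_den hq.2.2]
  exact (this _ le_rfl).1

/-! ### Correctness of compilation -/

/-- The program `P` contains the instructions `Q` from address `l` on. -/
def CodeAt (P : Program) (l : ℕ) (Q : Program) : Prop :=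
  ∀ j < Q.length, P[l + j]? = Q[j]?

theorem CodeAt.left {P Q R : Program} {l : ℕ} (h : CodeAt P l (Q ++ R)) : CodeAt P l Q := by
  intro j hj
  rw [h j (by simp; omega), List.getElem?_append_left hj]

theorem CodeAt.right {P Q R : Program} {l : ℕ} (h : CodeAt P l (Q ++ R)) :
    CodeAt P (l + Q.length) R := by
  intro j hj
  rw [add_assoc, h _ (by simp; omega), List.getElem?_append_right (by omega)]
  congr 1
  omega

theorem CodeAt.head {P Q : Program} {i : Instr} {l : ℕ} (h : CodeAt P l (i :: Q)) :
    P[l]? = some i := by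
  simpa using h 0 (by simp)

theorem CodeAt.tail {P Q : Program} {i : Instr} {l : ℕ} (h : CodeAt P l (i :: Q)) :
    CodeAt P (l + 1) Q :=
  CodeAt.right (Q := [i]) h

theorem step_at {P : Program} {l : ℕ} {i : Instr} (h : P[l]? = some i) (d : Data) :
    step P (d.at l) = exec (d.at l) i := by
  unfold step
  simp only [Data.at, h]

/-- The step count is exact and independent of the data, since loop bounds are the unchanging
registers `0` and `1`. This gives the checkpoints a fixed period. -/
theorem run_compile {P : Program} {n m : ℕ} (c : Cmd) (hc : wellFormed c = true) (l : ℕ)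
    (hP : CodeAt P l (compile c l)) (d : Data) (h0 : d.reg 0 = n) (h1 : d.reg 1 = m) :
    run P (d.at l) (cost n m c) = (den c d).at (l + size c) := by
  induction c generalizing l d with
  | seq c₁ c₂ ih₁ ih₂ =>
    simp only [wellFormed, Bool.and_eq_true] at hc
    simp only [cost, run_add, den, size]
    have hr := hP.right
    rw [length_compile] at hr
    rw [ih₁ hc.1 l hP.left d h0 h1, ih₂ hc.2 _ hr _
      (by rw [reg_den_of_lt_two hc.1 (by omega), h0])
      (by rw [reg_den_of_lt_two hc.1 (by omega), h1]), add_assoc]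
  | loop r k c ih =>
    simp only [wellFormed, Bool.and_eq_true, decide_eq_true_eq] at hc
    obtain ⟨⟨hr, hk, hkc⟩, hc⟩ := hc
    have i0 := hP.left.head
    have i1 := hP.left.tail.head
    have i2 := hP.left.tail.tail.head
    have hbody : CodeAt P (l + 3) (compile c (l + 3)) := hP.right.left
    have hend := hP.right.right
    rw [length_compile] at hend
    have e0 := hend.head
    have e1 := hend.tail.head
    have e2 := hend.tail.tail.head
    have e3 := hend.tail.tail.tail.head
    simp only [List.length_cons, List.length_nil, zero_add, Nat.reduceAdd] at e0 e1 e2 e3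
    have hcount : (if r = 0 then n else m) = d.reg r := by
      have : r = 0 ∨ r = 1 := by omega
      rcases this with rfl | rfl
      · simp [h0]
      · simp [h1]
    -- The run is followed from the loop test at `l + 2`. Each iteration costs the body, one test
    -- and four closing instructions; the extra 1 is the final test, which leaves the loop.
    have hloop : ∀ (j : ℕ) (e : Data), e.reg 0 = n → e.reg 1 = m → e.reg k = j →
        run P (e.at (l + 2)) (j * (cost n m c + 5) + 1) =
          ((fun s => tick k (den c s))^[j] e).at (l + (size c + 7)) := by
      intro j
      induction j with
      | zero =>
        intro e _ _ hj
        rw [zero_mul, zero_add, run_succ]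
        simp only [run, Function.iterate_zero, id]
        rw [step_at i2]
        simp [exec, Data.at, hj]
      | succ j ihj =>
        intro e he0 he1 hj
        have s1 : run P (e.at (l + 2)) 1 = e.at (l + 3) := by
          rw [run_succ]
          simp only [run, Function.iterate_zero, id]
          rw [step_at i2]
          simp [exec, Data.at, hj]
        have s2 := ih hc (l + 3) hbody e he0 he1
        -- Register `2` serves twice: as the 1 to be subtracted, then as the 0 that makes the jump
        -- back unconditional.
        have s3 : run P ((den c e).at (l + 3 + size c)) 4 =
            (tick k (den c e)).at (l + 2) := by
          simp only [run_succ]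
          simp only [run, Function.iterate_zero, id]
          rw [step_at e0]
          have hk2 : k ≠ 2 := by omega
          have t1 : exec ((den c e).at (l + 3 + size c)) (.const 2 1) =
            (den (.const 2 1) (den c e)).at (l + 3 + size c + 1) := rfl
          rw [t1, step_at e1]
          have t2 : ∀ d' : Data, exec (d'.at (l + 3 + size c + 1)) (.sub k k 2) =
            (den (.sub k k 2) d').at (l + 3 + size c + 1 + 1) := fun _ => rfl
          rw [t2, step_at e2]
          have t3 : ∀ d' : Data, exec (d'.at (l + 3 + size c + 1 + 1)) (.const 2 0) =
            (den (.const 2 0) d').at (l + 3 + size c + 1 + 1 + 1) := fun _ => rfl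
          rw [t3, step_at e3]
          simp only [exec, Data.at, den, tick, Function.update_self, if_true,
            Function.update_of_ne hk2]
          congr 1
          funext q
          simp only [Function.update_apply]
          split_ifs <;> rfl
        have hsplit : (j + 1) * (cost n m c + 5) + 1 =
            1 + (cost n m c + (4 + (j * (cost n m c + 5) + 1))) := by ring
        rw [hsplit, run_add, s1, run_add, s2, run_add, s3, Function.iterate_succ_apply]
        refine ihj _ ?_ ?_ ?_
        · rw [reg_tick _ (by omega) (by omega), reg_den_of_lt_two hc (by omega), he0]
        · rw [reg_tick _ (by omega) (by omega), reg_den_of_lt_two hc (by omega), he1]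
        · have hk2 : k ≠ 2 := by omega
          simp [tick, hk2, reg_den hkc, hj]
    have hfirst : run P (d.at l) 2 =
        Data.at { d with reg := Function.update d.reg k (d.reg r) } (l + 2) := by
      simp only [run_succ]
      simp only [run, Function.iterate_zero, id]
      rw [step_at i0]
      have t1 : exec (d.at l) (.const k 0) = (den (.const k 0) d).at (l + 1) := rfl
      rw [t1, step_at i1]
      have hrk : r ≠ k := by omega
      simp [exec, Data.at, den, hrk]
    have hsplit : cost n m (loop r k c) = 2 + (d.reg r * (cost n m c + 5) + 1) := by
      simp only [cost, hcount]
      ring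
    rw [hsplit, run_add, hfirst, hloop]
    · rfl
    · simp only
      rw [Function.update_of_ne (by omega), h0]
    · simp only
      rw [Function.update_of_ne (by omega), h1]
    · simp
  | _ =>
    simp only [cost, run_succ]
    simp only [run, Function.iterate_zero, id]
    rw [step_at hP.head]
    rfl

end Cmd

end RAM

/-! ### The enumeration program -/

namespace RomanEnum

open RAM RAM.Cmd

/-- With the matrix row at address `p` and the characteristic vector of `S` at address `B`, the
number of elements of `S` in the hyperedge. -/
def rowCount (mem : ℕ → ℕ) (B n p : ℕ) : ℕ :=
  ∑ y ∈ Finset.range n, (mem (p + y) - (1 - mem (B + y)))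

/-- The number of hyperedges that contain `x` and at most one element of `S`. -/
def privCount (mem : ℕ → ℕ) (B n m x : ℕ) : ℕ :=
  ∑ i ∈ Finset.range m, (mem (i * n + x) - (rowCount mem B n (i * n) - 1))

/-- The number of elements of `S` without a private hyperedge. -/
def defect (mem : ℕ → ℕ) (B n m : ℕ) : ℕ :=
  ∑ x ∈ Finset.range n, (mem (B + x) - privCount mem B n m x)

/-- The memory and the search flag after the first `j` positions have been treated in the search
for the next set. -/
def advanceState (mem : ℕ → ℕ) (B n m : ℕ) : ℕ → (ℕ → ℕ) × ℕ
  | 0 => (mem, 1)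
  | j + 1 =>
    let s := advanceState mem B n m j
    let old := s.1 (B + j)
    -- On 0/1 values, `ok` is 1 exactly if the search is still on, the position is vacant, and
    -- setting it leaves no vertex without a private hyperedge. The new cell content is `ok` while
    -- searching and the old content afterwards. Arithmetic replaces branching, so the time does not
    -- depend on the data.
    let ok := s.2 - old - defect (Function.update s.1 (B + j) 1) B n m
    (Function.update s.1 (B + j) (old - s.2 + ok), s.2 - ok)

/-- `reg 6` := number of elements of `S` in the row at `reg 5`. -/
def countRow : Cmd :=
  (const 6 0).seq <| (add 7 5 6).seq <| (add 8 4 6).seq <|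
  loop 0 11 ((load 9 7).seq <| (load 10 8).seq <| (sub 10 3 10).seq <| (sub 10 9 10).seq <|
      (add 6 6 10).seq <|
    (add 7 7 3).seq <| add 8 8 3)

/-- `reg 15` := number of hyperedges that contain `reg 13` and at most one element of `S`. -/
def countPrivate : Cmd :=
  (const 15 0).seq <| (const 5 0).seq <|
  loop 1 12 (countRow.seq <| (sub 6 6 3).seq <| (add 9 5 13).seq <| (load 9 9).seq <|
      (sub 9 9 6).seq <| (add 15 15 9).seq <|
    add 5 5 0)

/-- `reg 16` := number of elements of `S` without a private hyperedge. -/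
def countDefect : Cmd :=
  (const 16 0).seq <| (const 13 0).seq <| (add 17 4 16).seq <|
  loop 0 14 (countPrivate.seq <| (load 9 17).seq <| (sub 9 9 15).seq <| (add 16 16 9).seq <|
      (add 13 13 3).seq <|
    add 17 17 3)

/-- Replace `S` by its successor; `reg 22` is `0` if there is one. -/
def advance : Cmd :=
  (const 22 1).seq <| (const 18 0).seq <| (add 18 18 4).seq <|
  loop 0 19 ((load 20 18).seq <| (store 18 3).seq <| countDefect.seq <| (sub 21 22 20).seq <|
      (sub 21 21 16).seq <| (sub 9 20 22).seq <|
    (add 9 9 21).seq <| (store 18 9).seq <| (sub 22 22 21).seq <| add 18 18 3)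

/-- `reg 3` := 1 and `reg 4` := `m * n`. -/
def setup : Cmd :=
  (const 3 1).seq <| (const 4 0).seq <| loop 1 23 (add 4 4 0)

/-- Write the characteristic vector of the hyperedges that do not meet `S`. -/
def writeUnhit : Cmd :=
  (const 5 0).seq <| loop 1 12 (countRow.seq <| (sub 9 3 6).seq <| (write 9).seq <| add 5 5 0)

/-- Write the characteristic vector of `S`. -/
def writeSet : Cmd :=
  (const 8 0).seq <| (add 8 8 4).seq <| loop 0 12 ((load 9 8).seq <| (write 9).seq <| add 8 8 3)

/-- Set the registers in the list, and register `2`, to `0`. -/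
def reset : List ℕ → Cmd
  | [] => const 2 0
  | r :: l => (const r 0).seq <| reset l

/-- Reset all registers but the input and the search flag. -/
def clearRegisters : Cmd :=
  reset [3, 4, 5, 6, 7, 8, 9, 10, 11, 12, 13, 14, 15, 16, 17, 18, 19, 20, 21, 23]

/-- Output `S` and replace it by its successor. -/
def body : Cmd :=
  setup.seq <| writeUnhit.seq <| writeSet.seq <| emit.seq <| advance.seq <| clearRegisters

/-- Repeat `body` until there is no successor. -/
def program : Program :=
  compile body 0 ++ [.jumpZero 22 0]

theorem wellFormed_body : wellFormed body = true := by decide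

/-! ### Correctness of the subroutines. -/

theorem reg_countRow (d : Data) (h3 : d.reg 3 = 1) :
    (den countRow d).reg 6 = rowCount d.mem (d.reg 4) (d.reg 0) (d.reg 5) := by
  unfold countRow
  simp only [den_seq]
  generalize hf : den (add 8 4 6) _ = f
  have f0 : f.reg 0 = d.reg 0 := by rw [← hf]; simp [den]
  have f3 : f.reg 3 = 1 := by rw [← hf]; simp [den, h3]
  have f6 : f.reg 6 = 0 := by rw [← hf]; simp [den]
  have f7 : f.reg 7 = d.reg 5 := by rw [← hf]; simp [den]
  have f8 : f.reg 8 = d.reg 4 := by rw [← hf]; simp [den]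
  have fm : f.mem = d.mem := by rw [← hf]; rfl
  rw [← f0]
  refine (den_loop (fun j e => e.reg 6 = rowCount d.mem (d.reg 4) j (d.reg 5) ∧
    e.reg 7 = d.reg 5 + j ∧ e.reg 8 = d.reg 4 + j ∧ e.mem = d.mem) ?_ ?_).1
  · simp [f6, f7, f8, fm, rowCount]
  · rintro j e - hq ⟨e6, e7, e8, em⟩
    have e3 := hq 3 (by decide)
    rw [f3] at e3
    simp [den, tick, e3, e6, e7, e8, em, rowCount, Finset.sum_range_succ,
      add_assoc]

/-- The loop invariant is the partial sum together with the address of the current row. The inner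
count is replaced by its specification, and the frame rule protects the registers of the outer loop.
-/
theorem reg_countPrivate (d : Data) (h3 : d.reg 3 = 1) :
    (den countPrivate d).reg 15 =
      privCount d.mem (d.reg 4) (d.reg 0) (d.reg 1) (d.reg 13) := by
  unfold countPrivate
  simp only [den_seq]
  generalize hf : den (const 5 0) _ = f
  have f0 : f.reg 0 = d.reg 0 := by rw [← hf]; simp [den]
  have f1 : f.reg 1 = d.reg 1 := by rw [← hf]; simp [den]
  have f3 : f.reg 3 = 1 := by rw [← hf]; simp [den, h3]
  have f4 : f.reg 4 = d.reg 4 := by rw [← hf]; simp [den]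
  have f5 : f.reg 5 = 0 := by rw [← hf]; simp [den]
  have f13 : f.reg 13 = d.reg 13 := by rw [← hf]; simp [den]
  have f15 : f.reg 15 = 0 := by rw [← hf]; simp [den]
  have fm : f.mem = d.mem := by rw [← hf]; rfl
  rw [← f1]
  refine (den_loop (fun j e => e.reg 15 = privCount d.mem (d.reg 4) (d.reg 0) j (d.reg 13) ∧
    e.reg 5 = j * d.reg 0 ∧ e.mem = d.mem) ?_ ?_).1
  · simp [f5, f15, fm, privCount]
  · rintro j e - hq ⟨e15, e5, em⟩
    have e0 := hq 0 (by decide)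
    have e3 := hq 3 (by decide)
    have e4 := hq 4 (by decide)
    have e13 := hq 13 (by decide)
    rw [f0] at e0
    rw [f3] at e3
    rw [f4] at e4
    rw [f13] at e13
    have g6 := reg_countRow e e3
    rw [e0, e4, e5, em] at g6
    have g0 := reg_den (c := countRow) (r := 0) (by decide) e
    have g3 := reg_den (c := countRow) (r := 3) (by decide) e
    have g5 := reg_den (c := countRow) (r := 5) (by decide) e
    have g13 := reg_den (c := countRow) (r := 13) (by decide) e
    have g15 := reg_den (c := countRow) (r := 15) (by decide) e
    have gm := mem_den (c := countRow) (by decide) e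
    rw [den_seq]
    generalize den countRow e = g at *
    simp [den, tick, g0, g3, g5, g6, g13, g15, gm, e0, e3, e5, e13, e15, em, privCount,
      Finset.sum_range_succ, add_mul]

theorem reg_countDefect (d : Data) (h3 : d.reg 3 = 1) :
    (den countDefect d).reg 16 = defect d.mem (d.reg 4) (d.reg 0) (d.reg 1) := by
  unfold countDefect
  simp only [den_seq]
  generalize hf : den (add 17 4 16) _ = f
  have f0 : f.reg 0 = d.reg 0 := by rw [← hf]; simp [den]
  have f1 : f.reg 1 = d.reg 1 := by rw [← hf]; simp [den]
  have f3 : f.reg 3 = 1 := by rw [← hf]; simp [den, h3]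
  have f4 : f.reg 4 = d.reg 4 := by rw [← hf]; simp [den]
  have f13 : f.reg 13 = 0 := by rw [← hf]; simp [den]
  have f16 : f.reg 16 = 0 := by rw [← hf]; simp [den]
  have f17 : f.reg 17 = d.reg 4 := by rw [← hf]; simp [den]
  have fm : f.mem = d.mem := by rw [← hf]; rfl
  unfold defect
  have key := den_loop (r := 0) (k := 14) (c := countPrivate.seq <| (load 9 17).seq <|
      (sub 9 9 15).seq <|
    (add 16 16 9).seq <| (add 13 13 3).seq <| add 17 17 3) (d := f)
    (fun j e => e.reg 16 = ∑ x ∈ Finset.range j,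
      (d.mem (d.reg 4 + x) - privCount d.mem (d.reg 4) (d.reg 0) (d.reg 1) x) ∧
      e.reg 13 = j ∧ e.reg 17 = d.reg 4 + j ∧ e.mem = d.mem) ?_ ?_
  · rw [f0] at key
    exact key.1
  · simp [f13, f16, f17, fm]
  · rintro j e - hq ⟨e16, e13, e17, em⟩
    have e0 := hq 0 (by decide)
    have e1 := hq 1 (by decide)
    have e3 := hq 3 (by decide)
    have e4 := hq 4 (by decide)
    rw [f0] at e0
    rw [f1] at e1
    rw [f3] at e3
    rw [f4] at e4
    have g15 := reg_countPrivate e e3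
    rw [e0, e1, e4, e13, em] at g15
    have g3 := reg_den (c := countPrivate) (r := 3) (by decide) e
    have g13 := reg_den (c := countPrivate) (r := 13) (by decide) e
    have g16 := reg_den (c := countPrivate) (r := 16) (by decide) e
    have g17 := reg_den (c := countPrivate) (r := 17) (by decide) e
    have gm := mem_den (c := countPrivate) (by decide) e
    rw [den_seq]
    generalize den countPrivate e = g at *
    simp [den, tick, g3, g13, g15, g16, g17, gm, e3, e13, e16, e17, em,
      Finset.sum_range_succ, add_assoc]

theorem den_advance (d : Data) (h3 : d.reg 3 = 1) :
    (den advance d).mem = (advanceState d.mem (d.reg 4) (d.reg 0) (d.reg 1) (d.reg 0)).1 ∧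
      (den advance d).reg 22 =
        (advanceState d.mem (d.reg 4) (d.reg 0) (d.reg 1) (d.reg 0)).2 := by
  unfold advance
  simp only [den_seq]
  generalize hf : den (add 18 18 4) _ = f
  have f0 : f.reg 0 = d.reg 0 := by rw [← hf]; simp [den]
  have f1 : f.reg 1 = d.reg 1 := by rw [← hf]; simp [den]
  have f3 : f.reg 3 = 1 := by rw [← hf]; simp [den, h3]
  have f4 : f.reg 4 = d.reg 4 := by rw [← hf]; simp [den]
  have f18 : f.reg 18 = d.reg 4 := by rw [← hf]; simp [den]
  have f22 : f.reg 22 = 1 := by rw [← hf]; simp [den]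
  have fm : f.mem = d.mem := by rw [← hf]; rfl
  have key := den_loop (r := 0) (k := 19) (c := (load 20 18).seq <| (store 18 3).seq <|
      countDefect.seq <|
    (sub 21 22 20).seq <| (sub 21 21 16).seq <| (sub 9 20 22).seq <| (add 9 9 21).seq <|
        (store 18 9).seq <| (sub 22 22 21).seq <|
    add 18 18 3) (d := f)
    (fun j e => e.mem = (advanceState d.mem (d.reg 4) (d.reg 0) (d.reg 1) j).1 ∧
      e.reg 22 = (advanceState d.mem (d.reg 4) (d.reg 0) (d.reg 1) j).2 ∧
      e.reg 18 = d.reg 4 + j) ?_ ?_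
  · rw [f0] at key
    exact ⟨key.1, key.2.1⟩
  · simp [f18, f22, fm, advanceState]
  · rintro j e - hq ⟨em, e22, e18⟩
    have e0 := hq 0 (by decide)
    have e1 := hq 1 (by decide)
    have e3 := hq 3 (by decide)
    have e4 := hq 4 (by decide)
    rw [f0] at e0
    rw [f1] at e1
    rw [f3] at e3
    rw [f4] at e4
    simp only [advanceState]
    generalize advanceState d.mem (d.reg 4) (d.reg 0) (d.reg 1) j = s at *
    rw [den_seq, den_seq, den_seq]
    -- The state `p` has the current position tentatively set to 1; the old content is kept in
    -- register `20`.
    generalize hp : den (store 18 3) (den (load 20 18) e) = p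
    have p0 : p.reg 0 = d.reg 0 := by rw [← hp]; simp [den, e0]
    have p1 : p.reg 1 = d.reg 1 := by rw [← hp]; simp [den, e1]
    have p3 : p.reg 3 = 1 := by rw [← hp]; simp [den, e3]
    have p4 : p.reg 4 = d.reg 4 := by rw [← hp]; simp [den, e4]
    have p18 : p.reg 18 = d.reg 4 + j := by rw [← hp]; simp [den, e18]
    have p20 : p.reg 20 = s.1 (d.reg 4 + j) := by rw [← hp]; simp [den, e18, em]
    have p22 : p.reg 22 = s.2 := by rw [← hp]; simp [den, e22]
    have pm : p.mem = Function.update s.1 (d.reg 4 + j) 1 := by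
      rw [← hp]; simp [den, em, e18, e3]
    have g16 := reg_countDefect p p3
    rw [p0, p1, p4, pm] at g16
    have g3 := reg_den (c := countDefect) (r := 3) (by decide) p
    have g18 := reg_den (c := countDefect) (r := 18) (by decide) p
    have g20 := reg_den (c := countDefect) (r := 20) (by decide) p
    have g22 := reg_den (c := countDefect) (r := 22) (by decide) p
    have gm := mem_den (c := countDefect) (by decide) p
    generalize den countDefect p = g at *
    simp [den, tick, g3, g16, g18, g20, g22, gm, p3, p18, p20, p22, pm, add_assoc]

theorem den_setup (d : Data) : (den setup d).reg 3 = 1 ∧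
    (den setup d).reg 4 = d.reg 1 * d.reg 0 := by
  unfold setup
  simp only [den_seq]
  generalize hf : den (const 4 0) _ = f
  have f0 : f.reg 0 = d.reg 0 := by rw [← hf]; simp [den]
  have f1 : f.reg 1 = d.reg 1 := by rw [← hf]; simp [den]
  have f3 : f.reg 3 = 1 := by rw [← hf]; simp [den]
  have f4 : f.reg 4 = 0 := by rw [← hf]; simp [den]
  refine ⟨by rw [reg_den (by decide), f3], ?_⟩
  rw [← f1]
  refine den_loop (fun j e => e.reg 4 = j * d.reg 0) ?_ ?_
  · simp [f4]
  · intro j e _ hq e4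
    have e0 := hq 0 (by decide)
    rw [f0] at e0
    simp [den, tick, e0, e4, add_mul]

theorem word_writeUnhit (d : Data) (h3 : d.reg 3 = 1) :
    (den writeUnhit d).word = d.word ++ (List.range (d.reg 1)).map
      (fun i => 1 - rowCount d.mem (d.reg 4) (d.reg 0) (i * d.reg 0)) ∧
      (den writeUnhit d).out = d.out := by
  unfold writeUnhit
  simp only [den_seq]
  generalize hf : den (const 5 0) _ = f
  have f0 : f.reg 0 = d.reg 0 := by rw [← hf]; simp [den]
  have f1 : f.reg 1 = d.reg 1 := by rw [← hf]; simp [den]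
  have f3 : f.reg 3 = 1 := by rw [← hf]; simp [den, h3]
  have f4 : f.reg 4 = d.reg 4 := by rw [← hf]; simp [den]
  have f5 : f.reg 5 = 0 := by rw [← hf]; simp [den]
  have fm : f.mem = d.mem := by rw [← hf]; rfl
  have fw : f.word = d.word := by rw [← hf]; rfl
  have fo : f.out = d.out := by rw [← hf]; rfl
  rw [← f1]
  have key := den_loop (r := 1) (k := 12) (c := countRow.seq <| (sub 9 3 6).seq <|
      (write 9).seq <| add 5 5 0)
    (d := f) (fun j e => e.word = d.word ++ (List.range j).map
      (fun i => 1 - rowCount d.mem (d.reg 4) (d.reg 0) (i * d.reg 0)) ∧ e.out = d.out ∧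
    e.reg 5 = j * d.reg 0 ∧ e.mem = d.mem) ?_ ?_
  · exact ⟨key.1, key.2.1⟩
  · simp [f5, fm, fw, fo]
  · rintro j e - hq ⟨ew, eo, e5, em⟩
    have e0 := hq 0 (by decide)
    have e3 := hq 3 (by decide)
    have e4 := hq 4 (by decide)
    rw [f0] at e0
    rw [f3] at e3
    rw [f4] at e4
    have g6 := reg_countRow e e3
    rw [e0, e4, e5, em] at g6
    have g0 := reg_den (c := countRow) (r := 0) (by decide) e
    have g3 := reg_den (c := countRow) (r := 3) (by decide) e
    have g5 := reg_den (c := countRow) (r := 5) (by decide) e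
    have gm := mem_den (c := countRow) (by decide) e
    obtain ⟨gw, go⟩ := out_den (c := countRow) (by decide) e
    rw [den_seq]
    generalize den countRow e = g at *
    simp [den, tick, g0, g3, g5, g6, gm, gw, go, e0, e3, e5, em, ew, eo, List.range_succ,
      add_mul]

theorem word_writeSet (d : Data) (h3 : d.reg 3 = 1) :
    (den writeSet d).word = d.word ++ (List.range (d.reg 0)).map (fun x => d.mem (d.reg 4 + x)) ∧
      (den writeSet d).out = d.out := by
  unfold writeSet
  simp only [den_seq]
  generalize hf : den (add 8 8 4) _ = f
  have f0 : f.reg 0 = d.reg 0 := by rw [← hf]; simp [den]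
  have f3 : f.reg 3 = 1 := by rw [← hf]; simp [den, h3]
  have f8 : f.reg 8 = d.reg 4 := by rw [← hf]; simp [den]
  have fm : f.mem = d.mem := by rw [← hf]; rfl
  have fw : f.word = d.word := by rw [← hf]; rfl
  have fo : f.out = d.out := by rw [← hf]; rfl
  rw [← f0]
  have key := den_loop (r := 0) (k := 12) (c := (load 9 8).seq <| (write 9).seq <| add 8 8 3)
    (d := f) (fun j e => e.word = d.word ++ (List.range j).map (fun x => d.mem (d.reg 4 + x)) ∧
      e.out = d.out ∧ e.reg 8 = d.reg 4 + j ∧ e.mem = d.mem) ?_ ?_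
  · exact ⟨key.1, key.2.1⟩
  · simp [f8, fm, fw, fo]
  · rintro j e - hq ⟨ew, eo, e8, em⟩
    have e3 := hq 3 (by decide)
    rw [f3] at e3
    simp [den, tick, e3, e8, em, ew, eo, List.range_succ, add_assoc]

theorem reg_reset {l : List ℕ} {q : ℕ} (hq : q ∈ writes (reset l)) (d : Data) :
    (den (reset l) d).reg q = 0 := by
  induction l generalizing d with
  | nil =>
    simp only [reset, writes, List.mem_singleton] at hq
    simp [reset, den, hq]
  | cons r l ih =>
    rw [reset, den_seq]
    by_cases h : q ∈ writes (reset l)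
    · exact ih h _
    · simp only [reset, writes, List.mem_append, List.mem_singleton, h, or_false] at hq
      rw [reg_den h]
      simp [den, hq]

/-- The registers at the beginning of each execution of `body`. -/
def inputReg (n m : ℕ) : ℕ → ℕ := fun r => if r = 0 then n else if r = 1 then m else 0

/-- Apart from the search flag, a pass restores all registers to their input values, so the next
pass starts from the same form of state. -/
theorem den_body (n m : ℕ) (mem : ℕ → ℕ) (out : List (List ℕ)) :
    den body ⟨inputReg n m, mem, [], out⟩ =
      ⟨Function.update (inputReg n m) 22 (advanceState mem (m * n) n m n).2,
        (advanceState mem (m * n) n m n).1, [],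
        out ++ [(List.range m).map (fun i => 1 - rowCount mem (m * n) n (i * n)) ++
          (List.range n).map (fun x => mem (m * n + x))]⟩ := by
  generalize hd : (⟨inputReg n m, mem, [], out⟩ : Data) = d
  have d0 : d.reg 0 = n := by rw [← hd]; rfl
  have d1 : d.reg 1 = m := by rw [← hd]; rfl
  have dm : d.mem = mem := by rw [← hd]
  have dw : d.word = [] := by rw [← hd]
  have d_out : d.out = out := by rw [← hd]
  have hbody : ∀ q ∉ writes body, (den body d).reg q = inputReg n m q := by
    intro q hq
    rw [reg_den hq, ← hd]
  unfold body at hbody ⊢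
  simp only [den_seq] at hbody ⊢
  obtain ⟨a3, a4⟩ := den_setup d
  have a0 : (den setup d).reg 0 = n := by rw [reg_den (by decide), d0]
  have a1 : (den setup d).reg 1 = m := by rw [reg_den (by decide), d1]
  have am := mem_den (c := setup) (by decide) d
  obtain ⟨aw, ao⟩ := out_den (c := setup) (by decide) d
  rw [d0, d1] at a4
  rw [dm] at am
  rw [dw] at aw
  rw [d_out] at ao
  generalize den setup d = a at *
  obtain ⟨bw, bo⟩ := word_writeUnhit a a3
  have b0 := reg_den (c := writeUnhit) (r := 0) (by decide) a
  have b1 := reg_den (c := writeUnhit) (r := 1) (by decide) a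
  have b3 := reg_den (c := writeUnhit) (r := 3) (by decide) a
  have b4 := reg_den (c := writeUnhit) (r := 4) (by decide) a
  have bm := mem_den (c := writeUnhit) (by decide) a
  simp only [a0, a1, a3, a4, am, aw, ao, List.nil_append] at bw bo b0 b1 b3 b4 bm
  generalize den writeUnhit a = b at *
  obtain ⟨cw, co⟩ := word_writeSet b b3
  have c0 := reg_den (c := writeSet) (r := 0) (by decide) b
  have c1 := reg_den (c := writeSet) (r := 1) (by decide) b
  have c3 := reg_den (c := writeSet) (r := 3) (by decide) b
  have c4 := reg_den (c := writeSet) (r := 4) (by decide) b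
  have cm := mem_den (c := writeSet) (by decide) b
  simp only [b0, b1, b3, b4, bm, bw, bo] at cw co c0 c1 c3 c4 cm
  generalize den writeSet b = c at *
  have e0 : (den emit c).reg 0 = n := c0
  have e1 : (den emit c).reg 1 = m := c1
  have e3 : (den emit c).reg 3 = 1 := c3
  have e4 : (den emit c).reg 4 = m * n := c4
  have em : (den emit c).mem = mem := cm
  have ew : (den emit c).word = [] := rfl
  have eo : (den emit c).out = out ++ [c.word] := by rw [← co]; rfl
  rw [cw] at eo
  generalize den emit c = e at *
  obtain ⟨gm, g22⟩ := den_advance e e3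
  obtain ⟨gw, go⟩ := out_den (c := advance) (by decide) e
  simp only [e0, e1, e4, em, ew, eo] at gm g22 gw go
  generalize den advance e = g at *
  have hm := mem_den (c := clearRegisters) (by decide) g
  obtain ⟨hw, ho⟩ := out_den (c := clearRegisters) (by decide) g
  rw [gm] at hm
  rw [gw] at hw
  rw [go] at ho
  have hreg : (den clearRegisters g).reg =
      Function.update (inputReg n m) 22 (advanceState mem (m * n) n m n).2 := by
    funext q
    by_cases hq : q ∈ writes (setup.seq <| writeUnhit.seq <| writeSet.seq <| emit.seq <|
        advance.seq <| clearRegisters)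
    · have : q ∈ writes clearRegisters ∨ q = 22 := by
        revert q
        decide
      rcases this with hq | rfl
      · have : q ≠ 0 ∧ q ≠ 1 ∧ q ≠ 22 := by
          revert q
          decide
        rw [show (den clearRegisters g).reg q = 0 from reg_reset hq g,
          Function.update_of_ne this.2.2]
        simp [inputReg, this.1, this.2.1]
      · rw [reg_den (by decide), g22, Function.update_self]
    · rw [hbody q hq, Function.update_of_ne]
      rintro rfl
      exact hq (by decide)
  generalize den clearRegisters g = h at *
  cases h
  simp only at hm hw ho hreg
  rw [hm, hw, ho, hreg]

end RomanEnum

/-! ### The program on a hypergraph -/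

namespace RomanEnum

open RAM IndexedHypergraph

variable {n m : ℕ}

open Classical in
/-- The memory that holds the incidence matrix of `H` and the characteristic vector of `S`. -/
noncomputable def memory (H : IndexedHypergraph (Fin n) (Fin m)) (S : Finset (Fin n)) : ℕ → ℕ :=
  fun a => if ∃ (i : Fin m) (x : Fin n), a = i * n + x ∧ x ∈ H.edge i then 1
    else if ∃ x : Fin n, a = m * n + x ∧ x ∈ S then 1 else 0

theorem row_lt (i : Fin m) (x : Fin n) : (i : ℕ) * n + x < m * n := by
  have h1 := i.isLt
  have h2 := x.isLt
  have : ((i : ℕ) + 1) * n ≤ m * n := Nat.mul_le_mul_right n h1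
  rw [add_mul, one_mul] at this
  omega

theorem memory_matrix (H : IndexedHypergraph (Fin n) (Fin m)) (S : Finset (Fin n)) (i : Fin m)
    (x : Fin n) : memory H S (i * n + x) = if x ∈ H.edge i then 1 else 0 := by
  have h : (∃ (j : Fin m) (y : Fin n), (i : ℕ) * n + x = j * n + y ∧ y ∈ H.edge j) ↔
      x ∈ H.edge i := by
    refine ⟨?_, fun h => ⟨i, x, rfl, h⟩⟩
    rintro ⟨j, y, h, hy⟩
    have hn : 0 < n := Nat.zero_lt_of_lt x.isLt
    have hx : (x : ℕ) = y := by
      have := congrArg (· % n) h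
      simpa [Nat.add_mod, Nat.mod_eq_of_lt x.isLt, Nat.mod_eq_of_lt y.isLt] using this
    have hij : (i : ℕ) = j := by
      rw [hx] at h
      exact Nat.eq_of_mul_eq_mul_right hn (Nat.add_right_cancel h)
    rw [Fin.ext hx, Fin.ext hij]
    exact hy
  have h' : ¬ ∃ y : Fin n, (i : ℕ) * n + x = m * n + y ∧ y ∈ S := by
    rintro ⟨y, hy, -⟩
    have := row_lt i x
    omega
  simp only [memory, h, h', if_false]

theorem not_exists_row {H : IndexedHypergraph (Fin n) (Fin m)} {a : ℕ} (ha : m * n ≤ a) :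
    ¬ ∃ (i : Fin m) (x : Fin n), a = i * n + x ∧ x ∈ H.edge i := by
  rintro ⟨i, x, h, -⟩
  have := row_lt i x
  omega

theorem memory_set (H : IndexedHypergraph (Fin n) (Fin m)) (S : Finset (Fin n)) (x : Fin n) :
    memory H S (m * n + x) = if x ∈ S then 1 else 0 := by
  have h : (∃ y : Fin n, m * n + (x : ℕ) = m * n + y ∧ y ∈ S) ↔ x ∈ S := by
    refine ⟨?_, fun h => ⟨x, rfl, h⟩⟩
    rintro ⟨y, h, hy⟩
    rw [Fin.ext (Nat.add_left_cancel h)]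
    exact hy
  simp only [memory, not_exists_row (H := H) (Nat.le_add_right (m * n) x), if_false, h]

theorem memory_congr (H : IndexedHypergraph (Fin n) (Fin m)) {S T : Finset (Fin n)} {a : ℕ}
    (h : ∀ x : Fin n, a = m * n + x → (x ∈ S ↔ x ∈ T)) : memory H S a = memory H T a := by
  have : (∃ x : Fin n, a = m * n + x ∧ x ∈ S) ↔ ∃ x : Fin n, a = m * n + x ∧ x ∈ T :=
    exists_congr fun x => and_congr_right fun hx => h x hx
  simp only [memory, this]

theorem update_memory (H : IndexedHypergraph (Fin n) (Fin m)) {S T : Finset (Fin n)} (x : Fin n)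
    {b : ℕ} (hb : b = if x ∈ T then 1 else 0) (h : ∀ y, y ≠ x → (y ∈ S ↔ y ∈ T)) :
    Function.update (memory H S) (m * n + x) b = memory H T := by
  funext a
  rw [Function.update_apply]
  split_ifs with ha
  · rw [ha, memory_set, hb]
  · refine memory_congr H fun y hy => h y ?_
    rintro rfl
    exact ha hy

theorem memory_eq_zero (H : IndexedHypergraph (Fin n) (Fin m)) (S : Finset (Fin n)) {a : ℕ}
    (ha : m * n + n ≤ a) : memory H S a = 0 := by
  have h : ¬ ∃ y : Fin n, a = m * n + y ∧ y ∈ S := by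
    rintro ⟨y, hy, -⟩
    have := y.isLt
    omega
  simp only [memory, not_exists_row (H := H) (show m * n ≤ a by omega), h, if_false]

theorem memory_le_one (H : IndexedHypergraph (Fin n) (Fin m)) (S : Finset (Fin n)) (a : ℕ) :
    memory H S a ≤ 1 := by
  unfold memory
  split_ifs <;> simp

theorem rowCount_memory (H : IndexedHypergraph (Fin n) (Fin m)) (S : Finset (Fin n))
    (i : Fin m) : rowCount (memory H S) (m * n) n (i * n) = (H.edge i ∩ S).card := by
  unfold rowCount
  rw [Finset.sum_range]
  simp only [memory_matrix, memory_set]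
  have h : ∀ x : Fin n, (if x ∈ H.edge i then 1 else 0) - (1 - if x ∈ S then 1 else 0) =
      if x ∈ H.edge i ∩ S then 1 else 0 := by
    intro x
    by_cases h1 : x ∈ H.edge i <;> by_cases h2 : x ∈ S <;> simp [h1, h2]
  simp only [h, Finset.sum_boole, Finset.filter_univ_mem, Nat.cast_id]

/-- A sum of truncated differences vanishes only termwise. For `x ∈ S`, a hyperedge that contains
`x` and at most one element of `S` meets `S` in `x` alone, so a positive count means a private
hyperedge. -/
theorem defect_memory_eq_zero_iff (H : IndexedHypergraph (Fin n) (Fin m)) (S : Finset (Fin n)) :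
    defect (memory H S) (m * n) n m = 0 ↔ H.IsIrredundant Finset.univ S := by
  unfold defect privCount
  rw [Finset.sum_range, Finset.sum_eq_zero_iff]
  simp only [Finset.mem_univ, forall_true_left, memory_set]
  refine forall_congr' fun x => ?_
  by_cases hx : x ∈ S
  · rw [Finset.sum_range]
    simp only [rowCount_memory, memory_matrix, hx, if_true, forall_true_left]
    rw [Nat.sub_eq_zero_iff_le, Nat.one_le_iff_ne_zero, Ne, Finset.sum_eq_zero_iff]
    push Not
    refine exists_congr fun i => ?_
    simp only [Finset.mem_univ, true_and]
    by_cases hxi : x ∈ H.edge i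
    · have hm : x ∈ H.edge i ∩ S := Finset.mem_inter.2 ⟨hxi, hx⟩
      have hpos := Finset.card_pos.2 ⟨x, hm⟩
      rw [if_pos hxi]
      constructor
      · intro h
        obtain ⟨y, hy⟩ := Finset.card_eq_one.1 (show (H.edge i ∩ S).card = 1 by omega)
        rw [hy, Finset.mem_singleton] at hm
        rw [hy, hm]
      · intro h
        simp [h]
    · rw [if_neg hxi]
      constructor
      · intro h
        simp at h
      · intro h
        exact absurd (Finset.mem_inter.1 (h ▸ Finset.mem_singleton_self x)).1 hxi
  · simp [hx]

/-! ### Colexicographic successors. -/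

/-- The least set above `S` in the colexicographic order that differs from `S` first at `v`. -/
def candidate (S : Finset (Fin n)) (v : Fin n) : Finset (Fin n) :=
  insert v (S.filter (v < ·))

/-- `v` is the position at which the successor of `S` differs from `S`. -/
def IsPivot (H : IndexedHypergraph (Fin n) (Fin m)) (S : Finset (Fin n)) (v : Fin n) : Prop :=
  v ∉ S ∧ H.IsIrredundant Finset.univ (candidate S v)

/-- The search invariant: either no pivot has occurred and all treated positions are cleared, or the
least pivot has been found and the remaining passes change nothing. -/
theorem advanceState_memory (H : IndexedHypergraph (Fin n) (Fin m)) (S : Finset (Fin n))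
    (j : ℕ) (hj : j ≤ n) :
    (advanceState (memory H S) (m * n) n m j = (memory H (S.filter (j ≤ ·.val)), 1) ∧
      ∀ v : Fin n, v.val < j → ¬ IsPivot H S v) ∨
    ∃ v : Fin n, IsPivot H S v ∧ (∀ u < v, ¬ IsPivot H S u) ∧
      advanceState (memory H S) (m * n) n m j = (memory H (candidate S v), 0) := by
  induction j with
  | zero => exact Or.inl ⟨by simp [advanceState], by simp⟩
  | succ j ih =>
    rcases ih (by omega) with ⟨hs, hno⟩ | ⟨v, hv, hmin, hs⟩
    · obtain ⟨v, hv⟩ : ∃ v : Fin n, v.val = j := ⟨⟨j, hj⟩, rfl⟩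
      subst hv
      have hup : Function.update (memory H (S.filter (v.val ≤ ·.val))) (m * n + v) 1 =
          memory H (candidate S v) := by
        refine update_memory H v (by simp [candidate]) fun y hy => ?_
        have : y.val ≠ v.val := fun h => hy (Fin.ext h)
        simp only [candidate, Finset.mem_filter, Finset.mem_insert, hy, false_or, Fin.lt_def]
        exact and_congr_right fun _ => by omega
      have hdown : Function.update (memory H (S.filter (v.val ≤ ·.val))) (m * n + v) 0 =
          memory H (S.filter (v.val + 1 ≤ ·.val)) := by
        refine update_memory H v (by simp) fun y hy => ?_
        have : y.val ≠ v.val := fun h => hy (Fin.ext h)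
        simp only [Finset.mem_filter]
        exact and_congr_right fun _ => by omega
      have hold : memory H (S.filter (v.val ≤ ·.val)) (m * n + v) = if v ∈ S then 1 else 0 := by
        simp [memory_set]
      simp only [advanceState, hs, hup, hold]
      by_cases hp : IsPivot H S v
      · right
        refine ⟨v, hp, fun u hu => hno u hu, ?_⟩
        rw [(defect_memory_eq_zero_iff H _).2 hp.2, if_neg hp.1]
        exact Prod.ext hup rfl
      · left
        -- A position fails to be a pivot because it is occupied or because the defect is positive;
        -- either makes the truncated difference 0.
        have hok : 1 - (if v ∈ S then 1 else 0) -
            defect (memory H (candidate S v)) (m * n) n m = 0 := by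
          by_cases hvS : v ∈ S
          · simp [hvS]
          · have := mt (defect_memory_eq_zero_iff H (candidate S v)).1 fun h => hp ⟨hvS, h⟩
            omega
        refine ⟨?_, ?_⟩
        · rw [hok]
          have : (if v ∈ S then 1 else 0) - 1 + 0 = 0 := by split_ifs <;> rfl
          rw [this, hdown]
        · intro u hu
          rcases Nat.lt_succ_iff_lt_or_eq.1 hu with hu | hu
          · exact hno u hu
          · rw [Fin.ext hu]
            exact hp
    · right
      refine ⟨v, hv, hmin, ?_⟩
      simp [advanceState, hs]

theorem lt_candidate {S : Finset (Fin n)} {v : Fin n} (hv : v ∉ S) :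
    toColex S < toColex (candidate S v) := by
  rw [Finset.Colex.lt_iff_exists_filter_lt]
  refine ⟨v, by simp [candidate, hv], ?_⟩
  ext y
  simp only [candidate, Finset.mem_filter, Finset.mem_insert]
  constructor
  · rintro ⟨h1, h2⟩
    exact ⟨Or.inr ⟨h1, h2⟩, h2⟩
  · rintro ⟨rfl | h1, h2⟩
    · exact absurd h2 (lt_irrefl _)
    · exact h1

/-- Take for `v` the largest vertex where `S` and `T` differ. Then `candidate S v ⊆ T`, and
irredundance is inherited. -/
theorem exists_isPivot_of_lt {H : IndexedHypergraph (Fin n) (Fin m)} {S T : Finset (Fin n)}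
    (hT : H.IsIrredundant Finset.univ T) (hST : toColex S < toColex T) :
    ∃ v, IsPivot H S v ∧
      ∀ u ≤ v, toColex (candidate S u) ≤ toColex T := by
  obtain ⟨v, hv, h⟩ := Finset.Colex.lt_iff_exists_filter_lt.1 hST
  obtain ⟨hvT, hvS⟩ := Finset.mem_sdiff.1 hv
  have hsub : candidate S v ⊆ T := by
    unfold candidate
    rw [h]
    exact Finset.insert_subset hvT (Finset.filter_subset _ _)
  refine ⟨v, ⟨hvS, hT.subset hsub⟩, fun u hu => ?_⟩
  rcases hu.eq_or_lt with rfl | hu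
  · exact Finset.Colex.toColex_mono hsub
  -- For `u < v`, the candidate at `u` agrees with `S` from `v` upwards, so it still lacks `v` and
  -- lies below `T`.
  · refine (Finset.Colex.lt_iff_exists_filter_lt.2 ⟨v, ?_, ?_⟩).le
    · simp [candidate, hvT, hvS, hu.ne']
    · rw [← h]
      ext y
      simp only [candidate, Finset.mem_filter, Finset.mem_insert]
      constructor
      · rintro ⟨rfl | h1, h2⟩
        · exact absurd h2 hu.not_gt
        · exact ⟨h1.1, h2⟩
      · rintro ⟨h1, h2⟩
        exact ⟨Or.inr ⟨h1, hu.trans h2⟩, h2⟩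

/-- If there is an irredundant set above `S`, the search yields the least one. -/
theorem advanceState_of_isLeast {H : IndexedHypergraph (Fin n) (Fin m)} {S T : Finset (Fin n)}
    (hT : H.IsIrredundant Finset.univ T) (hST : toColex S < toColex T)
    (hmin : ∀ U, H.IsIrredundant Finset.univ U → toColex S < toColex U →
      toColex T ≤ toColex U) :
    advanceState (memory H S) (m * n) n m n = (memory H T, 0) := by
  obtain ⟨v, hv, hle⟩ := exists_isPivot_of_lt hT hST
  rcases advanceState_memory H S n le_rfl with ⟨-, hno⟩ | ⟨w, hw, hwmin, hs⟩
  · exact absurd hv (hno v v.isLt)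
  · have hwv : w ≤ v := le_of_not_gt fun h => hwmin v h hv
    -- The candidate at the least pivot is an irredundant set above `S`, hence not below `T`; and it
    -- is not above `T` because `w ≤ v`.
    have h := le_antisymm (hmin _ hw.2 (lt_candidate hw.1)) (hle w hwv)
    rw [hs, toColex_inj.1 h]

theorem advanceState_of_forall_le {H : IndexedHypergraph (Fin n) (Fin m)} {S : Finset (Fin n)}
    (hmax : ∀ U, H.IsIrredundant Finset.univ U → toColex U ≤ toColex S) :
    (advanceState (memory H S) (m * n) n m n).2 = 1 := by
  rcases advanceState_memory H S n le_rfl with ⟨hs, -⟩ | ⟨w, hw, -, -⟩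
  · rw [hs]
  · exact absurd (hmax _ hw.2) (lt_candidate hw.1).not_ge

end RomanEnum

/-! ### Minimal Roman hitting sets and irredundant sets -/

namespace IndexedHypergraph

variable {X I : Type} [DecidableEq X] [Fintype I]

/-- The indices of the hyperedges that do not meet `S`. -/
def unhit (H : IndexedHypergraph X I) (S : Finset X) : Finset I :=
  Finset.univ.filter fun i => H.edge i ∩ S = ∅

theorem mem_unhit {H : IndexedHypergraph X I} {S : Finset X} {i : I} :
    i ∈ H.unhit S ↔ H.edge i ∩ S = ∅ := by
  simp [unhit]

theorem isRomanHittingSet_unhit (H : IndexedHypergraph X I) (S : Finset X) :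
    H.IsRomanHittingSet (H.unhit S, S) := by
  intro i
  rcases (H.edge i ∩ S).eq_empty_or_nonempty with h | ⟨x, hx⟩
  · exact Or.inr (mem_unhit.2 h)
  · exact Or.inl ⟨x, Finset.mem_inter.1 hx⟩

theorem IsRomanHittingSet.unhit_subset {H : IndexedHypergraph X I} {R : Finset I × Finset X}
    (hR : H.IsRomanHittingSet R) : H.unhit R.2 ⊆ R.1 := by
  intro i hi
  rcases hR i with ⟨x, hx⟩ | h
  · have := Finset.mem_inter.2 hx
    rw [mem_unhit.1 hi] at this
    simp at this
  · exact h

/-- A minimal Roman hitting set is given by an irredundant set of vertices and the hyperedges that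
it does not meet. -/
theorem isMinimalRomanHittingSet_iff {H : IndexedHypergraph X I} {R : Finset I × Finset X} :
    H.IsMinimalRomanHittingSet R ↔
      H.IsIrredundant Finset.univ R.2 ∧ R.1 = H.unhit R.2 := by
  constructor
  · rintro ⟨hR, hmin⟩
    refine ⟨fun x hx => ?_, ?_⟩
    · by_contra! hno
      -- Without a private hyperedge, `x` is superfluous: every hyperedge it hits also contains
      -- another vertex of `R.2`.
      have hrhs : H.IsRomanHittingSet (R.1, R.2.erase x) := by
        intro i
        rcases hR i with ⟨y, hyi, hy⟩ | h
        · by_contra! hcon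
          refine hno i (Finset.mem_univ i) (Finset.eq_singleton_iff_unique_mem.2 ⟨?_, ?_⟩)
          · by_cases hyx : y = x
            · exact hyx ▸ Finset.mem_inter.2 ⟨hyi, hy⟩
            · exact absurd (Finset.mem_erase.2 ⟨hyx, hy⟩) (hcon.1 y hyi)
          · intro z hz
            obtain ⟨hzi, hz⟩ := Finset.mem_inter.1 hz
            by_contra hzx
            exact hcon.1 z hzi (Finset.mem_erase.2 ⟨hzx, hz⟩)
        · exact Or.inr h
      have := (hmin hrhs ⟨le_rfl, Finset.erase_subset _ _⟩).2 hx
      simp at this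
    · refine Finset.Subset.antisymm ?_ hR.unhit_subset
      exact (hmin (isRomanHittingSet_unhit H R.2) ⟨hR.unhit_subset, le_rfl⟩).1
  · rintro ⟨hirr, hR⟩
    refine ⟨?_, ?_⟩
    · have := isRomanHittingSet_unhit H R.2
      rwa [← hR] at this
    · intro Q hQ hQR
      -- A private hyperedge of `x` meets `R.2`, so its index is not in `R.1`; it must then be hit
      -- by `Q.2`, and only `x` can do that.
      have h2 : R.2 ⊆ Q.2 := by
        intro x hx
        obtain ⟨i, -, hi⟩ := hirr x hx
        rcases hQ i with ⟨y, hyi, hy⟩ | h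
        · have := Finset.mem_inter.2 ⟨hyi, hQR.2 hy⟩
          rw [hi, Finset.mem_singleton] at this
          exact this ▸ hy
        · have := hQR.1 h
          rw [hR, mem_unhit, hi] at this
          simp at this
      refine ⟨?_, h2⟩
      rw [hR, Finset.Subset.antisymm h2 hQR.2]
      exact hQ.unhit_subset

theorem setOf_isMinimalRomanHittingSet [Fintype X] (H : IndexedHypergraph X I) :
    {R | H.IsMinimalRomanHittingSet R} =
      (fun S => (H.unhit S, S)) '' (H.irredundantSets Finset.univ Finset.univ : Set _) := by
  ext R
  simp only [Set.mem_ofPred_eq, isMinimalRomanHittingSet_iff, Set.mem_image, Finset.mem_coe,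
    mem_irredundantSets, Finset.subset_univ, true_and]
  constructor
  · rintro ⟨h1, h2⟩
    exact ⟨R.2, h1, by rw [← h2]⟩
  · rintro ⟨S, hS, rfl⟩
    exact ⟨hS, rfl⟩

theorem ncard_setOf_isMinimalRomanHittingSet [Fintype X] (H : IndexedHypergraph X I) :
    {R | H.IsMinimalRomanHittingSet R}.ncard =
      (H.irredundantSets Finset.univ Finset.univ).card := by
  rw [setOf_isMinimalRomanHittingSet, Set.ncard_image_of_injective, Set.ncard_coe_finset]
  intro S T h
  exact congrArg Prod.snd h

end IndexedHypergraph

/-! ### The run of the program -/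

namespace RomanEnum

open RAM RAM.Cmd IndexedHypergraph

variable {n m : ℕ}

theorem encode_injective :
    Function.Injective (encode : Finset (Fin m) × Finset (Fin n) → List ℕ) := by
  intro R Q h
  obtain ⟨h1, h2⟩ := List.append_inj h (by simp)
  have h1 := List.ofFn_injective h1
  have h2 := List.ofFn_injective h2
  refine Prod.ext (Finset.ext fun i => ?_) (Finset.ext fun x => ?_)
  · have := congrFun h1 i
    by_cases a : i ∈ R.1 <;> by_cases b : i ∈ Q.1 <;> simp_all
  · have := congrFun h2 x
    by_cases a : x ∈ R.2 <;> by_cases b : x ∈ Q.2 <;> simp_all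

/-- The output word for the set `S`. -/
def wordOf (H : IndexedHypergraph (Fin n) (Fin m)) (S : Finset (Fin n)) : List ℕ :=
  encode (H.unhit S, S)

theorem wordOf_injective (H : IndexedHypergraph (Fin n) (Fin m)) :
    Function.Injective (wordOf H) := fun _ _ h => congrArg Prod.snd (encode_injective h)

theorem map_range_eq_wordOf (H : IndexedHypergraph (Fin n) (Fin m)) (S : Finset (Fin n)) :
    (List.range m).map (fun i => 1 - rowCount (memory H S) (m * n) n (i * n)) ++
      (List.range n).map (fun x => memory H S (m * n + x)) = wordOf H S := by
  unfold wordOf encode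
  congr 1
  · refine List.ext_getElem (by simp) fun i h1 h2 => ?_
    have hi : i < m := by simpa using h1
    simp only [List.getElem_map, List.getElem_range, List.getElem_ofFn, mem_unhit]
    rw [rowCount_memory H S ⟨i, hi⟩]
    split_ifs with h
    · simp [h]
    · have := Finset.card_pos.2 (Finset.nonempty_iff_ne_empty.2 h)
      omega
  · refine List.ext_getElem (by simp) fun x h1 h2 => ?_
    have hx : x < n := by simpa using h1
    simp only [List.getElem_map, List.getElem_range, List.getElem_ofFn]
    exact memory_set H S ⟨x, hx⟩

/-- The contents of the machine before the set `S` is output. -/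
noncomputable def checkpoint (H : IndexedHypergraph (Fin n) (Fin m)) (S : Finset (Fin n))
    (out : List (List ℕ)) : Data :=
  ⟨inputReg n m, memory H S, [], out⟩

theorem start_eq (H : IndexedHypergraph (Fin n) (Fin m)) :
    start H = (checkpoint H ∅ []).at 0 := by
  unfold start checkpoint Data.at inputReg
  congr 1
  funext a
  simp [memory]

/-- The time between two checkpoints. -/
def period (n m : ℕ) : ℕ := cost n m body + 1

theorem run_period (H : IndexedHypergraph (Fin n) (Fin m)) (S : Finset (Fin n))
    (out : List (List ℕ)) :
    run program ((checkpoint H S out).at 0) (period n m) =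
      Data.at ⟨Function.update (inputReg n m) 22 (advanceState (memory H S) (m * n) n m n).2,
        (advanceState (memory H S) (m * n) n m n).1, [], out ++ [wordOf H S]⟩
        (if (advanceState (memory H S) (m * n) n m n).2 = 0 then 0 else program.length) := by
  have hcode : CodeAt program 0 (compile body 0) := by
    intro j hj
    rw [zero_add, program, List.getElem?_append_left hj]
  have hlast : program[0 + size body]? = some (.jumpZero 22 0) := by
    rw [program, zero_add, ← length_compile body 0, List.getElem?_concat_length]
  have hlen : program.length = size body + 1 := by
    simp [program, length_compile]
  have hrun := run_compile (n := n) (m := m) body wellFormed_body 0 hcode (checkpoint H S out)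
    rfl rfl
  rw [period, run_succ, hrun, step_at hlast, checkpoint, den_body, map_range_eq_wordOf, hlen]
  simp [exec, Data.at]

theorem run_period_of_isLeast {H : IndexedHypergraph (Fin n) (Fin m)} {S T : Finset (Fin n)}
    (hT : H.IsIrredundant Finset.univ T) (hST : toColex S < toColex T)
    (hmin : ∀ U, H.IsIrredundant Finset.univ U → toColex S < toColex U →
      toColex T ≤ toColex U) (out : List (List ℕ)) :
    run program ((checkpoint H S out).at 0) (period n m) =
      (checkpoint H T (out ++ [wordOf H S])).at 0 := by
  rw [run_period, advanceState_of_isLeast hT hST hmin, if_pos rfl, checkpoint]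
  congr 2
  -- A successful search leaves 0 in register `22`, which is its value in `inputReg`; the state is
  -- again an exact checkpoint.
  exact Function.update_eq_self_iff.2 rfl

/-- All irredundant sets in colexicographic order. -/
def sortedSets (H : IndexedHypergraph (Fin n) (Fin m)) : List (Colex (Finset (Fin n))) :=
  ((H.irredundantSets Finset.univ Finset.univ).map toColex.toEmbedding).sort

theorem mem_sortedSets {H : IndexedHypergraph (Fin n) (Fin m)} {S : Colex (Finset (Fin n))} :
    S ∈ sortedSets H ↔ H.IsIrredundant Finset.univ (ofColex S) := by
  simp only [sortedSets, Finset.mem_sort, Finset.mem_map, mem_irredundantSets,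
    Finset.subset_univ, true_and]
  constructor
  · rintro ⟨T, hT, rfl⟩
    exact hT
  · intro h
    exact ⟨_, h, rfl⟩

theorem sortedLT_sortedSets (H : IndexedHypergraph (Fin n) (Fin m)) :
    (sortedSets H).SortedLT := Finset.sortedLT_sort _

theorem length_sortedSets (H : IndexedHypergraph (Fin n) (Fin m)) :
    (sortedSets H).length = (H.irredundantSets Finset.univ Finset.univ).card := by
  simp [sortedSets]

theorem length_sortedSets_pos (H : IndexedHypergraph (Fin n) (Fin m)) :
    0 < (sortedSets H).length :=
  List.length_pos_of_mem (mem_sortedSets.2 (H.isIrredundant_empty _) : toColex ∅ ∈ sortedSets H)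

/-- The words output before the set number `k`. -/
def outputs (H : IndexedHypergraph (Fin n) (Fin m)) (k : ℕ) : List (List ℕ) :=
  ((sortedSets H).take k).map fun S => wordOf H (ofColex S)

theorem outputs_succ (H : IndexedHypergraph (Fin n) (Fin m)) {k : ℕ}
    (hk : k < (sortedSets H).length) :
    outputs H (k + 1) = outputs H k ++ [wordOf H (ofColex (sortedSets H)[k])] := by
  rw [outputs, outputs, List.take_succ_eq_append_getElem hk, List.map_append]
  rfl

/-- Each period moves from one irredundant set to the next in colexicographic order. -/
theorem run_mul_period (H : IndexedHypergraph (Fin n) (Fin m)) (k : ℕ)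
    (hk : k < (sortedSets H).length) :
    run program (start H) (k * period n m) =
      (checkpoint H (ofColex (sortedSets H)[k]) (outputs H k)).at 0 := by
  induction k with
  | zero =>
    -- The empty set is irredundant and the least set in the order; the input memory, being zero
    -- beyond the matrix, already encodes it.
    have h : (sortedSets H)[0] = toColex ∅ := by
      obtain ⟨i, hi, h⟩ := List.getElem_of_mem
        (mem_sortedSets.2 (H.isIrredundant_empty _) : toColex ∅ ∈ sortedSets H)
      refine le_antisymm ?_ bot_le
      rw [← h, (sortedLT_sortedSets H).getElem_le_getElem_iff]
      exact Nat.zero_le i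
    rw [zero_mul, h]
    exact start_eq H
  | succ k ih =>
    rw [add_mul, one_mul, run_add, ih (by omega), outputs_succ H (by omega)]
    refine run_period_of_isLeast (mem_sortedSets.1 (List.getElem_mem hk)) ?_ ?_ _
    · exact (sortedLT_sortedSets H).getElem_lt_getElem_iff.2 (Nat.lt_succ_self k)
    · intro U hU hlt
      obtain ⟨i, hi, h⟩ := List.getElem_of_mem
        (mem_sortedSets.2 hU : toColex U ∈ sortedSets H)
      rw [← h] at hlt ⊢
      exact (sortedLT_sortedSets H).getElem_le_getElem_iff.2
        ((sortedLT_sortedSets H).getElem_lt_getElem_iff.1 hlt)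

theorem run_last (H : IndexedHypergraph (Fin n) (Fin m)) :
    Halted program (run program (start H) ((sortedSets H).length * period n m)) ∧
      (run program (start H) ((sortedSets H).length * period n m)).out =
        outputs H (sortedSets H).length := by
  have hpos := length_sortedSets_pos H
  obtain ⟨k, hk⟩ : ∃ k, (sortedSets H).length = k + 1 := ⟨_, (Nat.sub_add_cancel hpos).symm⟩
  have hmax : ∀ U, H.IsIrredundant Finset.univ U →
      toColex U ≤ toColex (ofColex ((sortedSets H)[k]'(by omega))) := by
    intro U hU
    obtain ⟨i, hi, h⟩ := List.getElem_of_mem (mem_sortedSets.2 hU : toColex U ∈ sortedSets H)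
    rw [← h]
    exact (sortedLT_sortedSets H).getElem_le_getElem_iff.2 (by omega)
  rw [hk, add_mul, one_mul, run_add, run_mul_period H k (by omega), run_period,
    advanceState_of_forall_le hmax, outputs_succ H (by omega)]
  exact ⟨le_rfl, rfl⟩

theorem length_out_mul_period (H : IndexedHypergraph (Fin n) (Fin m)) (k : ℕ)
    (hk : k ≤ (sortedSets H).length) :
    (run program (start H) (k * period n m)).out.length = k := by
  rcases hk.eq_or_lt with rfl | hk
  · simp [(run_last H).2, outputs]
  · rw [run_mul_period H k hk]
    simp [checkpoint, Data.at, outputs, hk.le]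

theorem nodup_outputs (H : IndexedHypergraph (Fin n) (Fin m)) :
    (outputs H (sortedSets H).length).Nodup := by
  rw [outputs, List.take_length]
  exact (sortedLT_sortedSets H).nodup.map fun S T h => ofColex_inj.1 (wordOf_injective H h)

theorem mem_outputs (H : IndexedHypergraph (Fin n) (Fin m)) (w : List ℕ) :
    w ∈ outputs H (sortedSets H).length ↔
      ∃ R : Finset (Fin m) × Finset (Fin n), H.IsMinimalRomanHittingSet R ∧ w = encode R := by
  rw [outputs, List.take_length, List.mem_map]
  constructor
  · rintro ⟨S, hS, rfl⟩
    exact ⟨_, isMinimalRomanHittingSet_iff.2 ⟨mem_sortedSets.1 hS, rfl⟩, rfl⟩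
  · rintro ⟨R, hR, rfl⟩
    obtain ⟨h1, h2⟩ := isMinimalRomanHittingSet_iff.1 hR
    refine ⟨toColex R.2, mem_sortedSets.2 h1, ?_⟩
    rw [wordOf, ofColex_toColex, ← h2]

/-! ### Resource bounds. -/

/-- At a checkpoint only the two input registers and the `m * n + n` cells of matrix and set can be
nonzero. The slack `b` leaves room for the constants of the program. -/
theorem sizeLE_checkpoint (H : IndexedHypergraph (Fin n) (Fin m)) (S : Finset (Fin n))
    (out : List (List ℕ)) (b : ℕ) :
    Config.SizeLE ((checkpoint H S out).at 0) ((n + m) ^ 2 + (n + m) + 2)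
      (b + ((n + m) ^ 2 + (n + m) + 1)) := by
  have hmn : m * n + n ≤ (n + m) ^ 2 + (n + m) := by nlinarith
  have hlt : (n + m) ^ 2 + (n + m) + 1 < 2 ^ (b + ((n + m) ^ 2 + (n + m) + 1)) :=
    (Nat.lt_two_pow_self).trans_le (Nat.pow_le_pow_right (by norm_num) (by omega))
  constructor
  · refine ⟨{0, 1}, Finset.card_le_two.trans (by omega), ?_, ?_, ?_⟩
    · intro a ha
      simp only [Finset.mem_insert, Finset.mem_singleton] at ha
      omega
    · intro a ha
      simp only [Finset.mem_insert, Finset.mem_singleton, not_or] at ha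
      simp [checkpoint, Data.at, inputReg, ha]
    · intro a
      simp only [checkpoint, Data.at, inputReg]
      split_ifs <;> omega
  · refine ⟨Finset.range (m * n + n), ?_, ?_, ?_, ?_⟩
    · rw [Finset.card_range]
      omega
    · intro a ha
      have := Finset.mem_range.1 ha
      omega
    · intro a ha
      exact memory_eq_zero H S (by simpa using ha)
    · intro a
      have := memory_le_one H S a
      simp only [checkpoint, Data.at]
      omega

end RomanEnum

theorem RAM.SpaceLE.mono {c : RAM.Config} {b b' : ℕ} (h : RAM.SpaceLE c b) (hb : b ≤ b') :
    RAM.SpaceLE c b' := by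
  obtain ⟨b₁, b₂, h1, h2, h3⟩ := h
  exact ⟨b₁, b₂, h1, h2, h3.trans hb⟩

namespace RomanEnum

open RAM RAM.Cmd IndexedHypergraph

variable {n m : ℕ}

/-- A polynomial bound for the time between two checkpoints. -/
noncomputable def periodPoly : Polynomial ℕ := costPoly body + 1

theorem period_le (n m : ℕ) : period n m ≤ periodPoly.eval (n + m) := by
  have := cost_le n m body
  simp only [period, periodPoly, Polynomial.eval_add, Polynomial.eval_one]
  omega

open Polynomial in
/-- A polynomial bound for the memory in use if the instructions have at most `b` bits. -/
noncomputable def spacePoly (b : ℕ) : Polynomial ℕ :=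
  2 * ((X ^ 2 + X + 2 + periodPoly) * (2 * (C b + (X ^ 2 + X + 1) + periodPoly) + 1))

theorem card_le (H : IndexedHypergraph (Fin n) (Fin m)) :
    ((H.irredundantSets Finset.univ Finset.univ).card : ℝ) ≤
      (3 : ℝ) ^ (((n : ℝ) + (m : ℝ)) / 3) := by
  have h := H.cardBound Finset.univ Finset.univ
  rw [CardBound, Finset.card_fin, Finset.card_fin, cbrtThree_pow] at h
  exact_mod_cast h

theorem exists_program : ∃ (P : RAM.Program) (time delay space : Polynomial ℕ),
      ∀ (n m : ℕ) (H : IndexedHypergraph (Fin n) (Fin m)),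
        ∃ T : ℕ,
          RomanEnum.EnumeratesInTime P H T ∧
          (T : ℝ) ≤ ((time.eval (n + m) : ℕ) : ℝ) * (3 : ℝ) ^ (((n : ℝ) + (m : ℝ)) / 3) ∧
          RomanEnum.DelayLE P H T (delay.eval (n + m)) ∧
          ∀ t ≤ T, RAM.SpaceLE (RAM.run P (RomanEnum.start H) t) (space.eval (n + m)) := by
  obtain ⟨b, hb⟩ := exists_forall_sizeLE program
  refine ⟨program, periodPoly, 2 * periodPoly, spacePoly b, fun n m H => ?_⟩
  have hper := period_le n m
  obtain ⟨T, hT, hhalt, hrun, hdelay, hcover⟩ := exists_haltsAt_of_checkpoints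
    (P := program) (c := start H) (d := period n m) (N := (sortedSets H).length)
    (Nat.succ_pos _) (length_sortedSets_pos H) (length_out_mul_period H) (run_last H).1
  refine ⟨T, ⟨hhalt, ?_, ?_⟩, ?_, ?_, ?_⟩
  · rw [hrun, (run_last H).2]
    exact nodup_outputs H
  · rw [hrun, (run_last H).2]
    exact mem_outputs H
  · have h1 : (T : ℝ) ≤ ((sortedSets H).length : ℝ) * (period n m : ℝ) := by exact_mod_cast hT
    have h2 : (period n m : ℝ) ≤ ((periodPoly.eval (n + m) : ℕ) : ℝ) := by exact_mod_cast hper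
    rw [length_sortedSets, mul_comm] at h1
    exact h1.trans (mul_le_mul h2 (card_le H) (Nat.cast_nonneg _) (Nat.cast_nonneg _))
  · intro t ht
    have hd : 2 * period n m ≤ (2 * periodPoly).eval (n + m) := by
      simp only [Polynomial.eval_mul, Polynomial.eval_ofNat]
      omega
    rcases hdelay t ht with h | h
    · exact Or.inl (by omega)
    · exact Or.inr (h.trans_le (monotone_out_length program (start H) (by omega)))
  · intro t ht
    -- Growth is counted from the preceding checkpoint only, so it is bounded by one period and not
    -- by the exponential total time.
    obtain ⟨k, hk, j, hj, h⟩ := hcover t ht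
    rw [h, run_mul_period H k hk]
    have hsize := (sizeLE_checkpoint H (ofColex (sortedSets H)[k]) (outputs H k) b).run
      (P := program) (fun i hi => (hb i hi).mono (by omega)) j
    refine hsize.spaceLE.mono ?_
    simp only [spacePoly, Polynomial.eval_mul, Polynomial.eval_add, Polynomial.eval_pow,
      Polynomial.eval_X, Polynomial.eval_ofNat, Polynomial.eval_C, Polynomial.eval_one]
    rw [← two_mul]
    have : j ≤ periodPoly.eval (n + m) := hj.trans hper
    gcongr

/-! ### Tightness -/

/-- `k` disjoint hyperedges with two vertices each. -/
def disjointPairs (k : ℕ) : IndexedHypergraph (Fin (2 * k)) (Fin k) where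
  edge i := Finset.univ.filter fun x => x.val / 2 = i.val

/-- The set that contains the element number `f i` of the hyperedge number `i` if `f i < 2`, and
none of its elements otherwise. -/
def choiceSet {k : ℕ} (f : Fin k → Fin 3) : Finset (Fin (2 * k)) :=
  Finset.univ.filter fun x => x.val % 2 = (f ⟨x.val / 2, by omega⟩).val

/-- At most one vertex of each pair is chosen, so the pair itself is a private hyperedge of that
vertex. -/
theorem choiceSet_mem {k : ℕ} (f : Fin k → Fin 3) :
    choiceSet f ∈ (disjointPairs k).irredundantSets Finset.univ Finset.univ := by
  refine mem_irredundantSets.2 ⟨Finset.subset_univ _, fun x hx => ?_⟩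
  refine ⟨⟨x.val / 2, by omega⟩, Finset.mem_univ _,
    Finset.eq_singleton_iff_unique_mem.2 ⟨?_, ?_⟩⟩
  · exact Finset.mem_inter.2 ⟨by simp [disjointPairs], hx⟩
  · intro y hy
    obtain ⟨hy1, hy2⟩ := Finset.mem_inter.1 hy
    simp only [disjointPairs, choiceSet, Finset.mem_filter, Finset.mem_univ, true_and]
      at hx hy1 hy2
    simp only [hy1] at hy2
    exact Fin.ext (by omega)

theorem choiceSet_injective (k : ℕ) :
    Function.Injective (choiceSet : (Fin k → Fin 3) → Finset (Fin (2 * k))) := by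
  -- A value below 2 is visible as a chosen vertex; the value 2 is recognized by the absence of both
  -- vertices.
  have key : ∀ (f g : Fin k → Fin 3), choiceSet f = choiceSet g → ∀ i, (f i).val < 2 →
      f i = g i := by
    intro f g h i hi
    have hx : 2 * i.val + (f i).val < 2 * k := by omega
    have hdiv : (2 * i.val + (f i).val) / 2 = i.val := by omega
    have hmem : (⟨2 * i.val + (f i).val, hx⟩ : Fin (2 * k)) ∈ choiceSet f := by
      simp only [choiceSet, Finset.mem_filter, Finset.mem_univ, true_and, hdiv, Fin.eta]
      omega
    rw [h] at hmem
    simp only [choiceSet, Finset.mem_filter, Finset.mem_univ, true_and, hdiv, Fin.eta] at hmem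
    exact Fin.ext (by omega)
  intro f g h
  funext i
  by_cases h1 : (f i).val < 2
  · exact key f g h i h1
  by_cases h2 : (g i).val < 2
  · exact (key g f h.symm i h2).symm
  · exact Fin.ext (by omega)

theorem rpow_disjointPairs (k : ℕ) :
    (3 : ℝ) ^ ((((2 * k : ℕ) : ℝ) + (k : ℝ)) / 3) = 3 ^ k := by
  rw [← Real.rpow_natCast]
  congr 1
  push_cast
  ring

/-- The upper bound is the general one, so it is enough to exhibit 3^k distinct irredundant sets. -/
theorem card_disjointPairs (k : ℕ) :
    (((disjointPairs k).irredundantSets Finset.univ Finset.univ).card : ℝ) = 3 ^ k := by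
  refine le_antisymm ?_ ?_
  · rw [← rpow_disjointPairs]
    exact card_le (disjointPairs k)
  · have h := Finset.card_le_card_of_injOn (s := Finset.univ) choiceSet
      (fun f _ => choiceSet_mem f) (choiceSet_injective k).injOn
    rw [Finset.card_univ, Fintype.card_fun, Fintype.card_fin, Fintype.card_fin] at h
    exact_mod_cast h

/-- A program needs at least one step per output. -/
theorem ncard_le_of_enumeratesInTime {P : Program} {H : IndexedHypergraph (Fin n) (Fin m)}
    {T : ℕ} (h : EnumeratesInTime P H T) :
    {R | H.IsMinimalRomanHittingSet R}.ncard ≤ T := by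
  obtain ⟨-, -, hmem⟩ := h
  have himage : encode '' {R | H.IsMinimalRomanHittingSet R} =
      ((run P (start H) T).out.toFinset : Set (List ℕ)) := by
    ext w
    simp only [Set.mem_image, Set.mem_ofPred_eq, List.coe_toFinset, hmem]
    exact exists_congr fun R => and_congr_right fun _ => eq_comm
  rw [← Set.ncard_image_of_injective _ encode_injective, himage, Set.ncard_coe_finset]
  refine (List.toFinset_card_le _).trans ?_
  simpa [start] using out_length_run_le P (start H) T

end RomanEnum

theorem mainTheorem10 :
    (∃ (P : RAM.Program) (time delay space : Polynomial ℕ),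
      ∀ (n m : ℕ) (H : IndexedHypergraph (Fin n) (Fin m)),
        ∃ T : ℕ,
          RomanEnum.EnumeratesInTime P H T ∧
          (T : ℝ) ≤ ((time.eval (n + m) : ℕ) : ℝ) * (3 : ℝ) ^ (((n : ℝ) + (m : ℝ)) / 3) ∧
          RomanEnum.DelayLE P H T (delay.eval (n + m)) ∧
          ∀ t ≤ T, RAM.SpaceLE (RAM.run P (RomanEnum.start H) t) (space.eval (n + m))) ∧
    (∀ k : ℕ, ∃ (n m : ℕ) (H : IndexedHypergraph (Fin n) (Fin m)),
      n = 2 * k ∧ m = k ∧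
      (({R | H.IsMinimalRomanHittingSet R} : Set (Finset (Fin m) × Finset (Fin n))).ncard : ℝ) =
        (3 : ℝ) ^ (((n : ℝ) + (m : ℝ)) / 3) ∧
      ∀ (P : RAM.Program) (T : ℕ), RomanEnum.EnumeratesInTime P H T →
        (3 : ℝ) ^ (((n : ℝ) + (m : ℝ)) / 3) ≤ (T : ℝ)) := by
  refine ⟨RomanEnum.exists_program, fun k =>
    ⟨2 * k, k, RomanEnum.disjointPairs k, rfl, rfl, ?_, fun P T h => ?_⟩⟩
  · rw [IndexedHypergraph.ncard_setOf_isMinimalRomanHittingSet, RomanEnum.card_disjointPairs,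
      RomanEnum.rpow_disjointPairs]
  · have hle := RomanEnum.ncard_le_of_enumeratesInTime h
    rw [IndexedHypergraph.ncard_setOf_isMinimalRomanHittingSet] at hle
    rw [RomanEnum.rpow_disjointPairs, ← RomanEnum.card_disjointPairs]
    exact_mod_cast hle
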